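/- **Setting.** A three-source three-destination multiple unicast network with delays is a directed acyclic multigraph with finitely many links, each of unit delay, with sources $S_1,S_2,S_3$ and destinations $T_1,T_2,T_3$; $S_i$ generates one process, demanded by $T_i$. With local encoding coefficients (LECs) $\underline\varepsilon=(\alpha_{i,e},\beta_{e',e},\epsilon_{e,j})$, the symbols $Z(e)$ on the links and the outputs $Y_j$ satisfy $Z^{(t+1)}(e)=\sum_{i:\,S_i=\mathrm{tail}(e)}\alpha_{i,e}X_i^{(t)}+\sum_{\mathrm{head}(e')=\mathrm{tail}(e)}\beta_{e',e}Z^{(t)}(e')$ and $Y_j^{(t+1)}=\sum_{\mathrm{head}(e)=T_j}\epsilon_{e,j}Z^{(t)}(e)$. Let $M_{ij}(\underline\varepsilon,D)$ be the resulting transfer polynomial in the delay parameter $D$ from $S_i$ to $T_j$. All fields are of the form $\mathbb F_{2^m}$. For a DFT parameter $\alpha$ put $M_{ij}(q)=M_{ij}(\underline\varepsilon,\alpha^q)$ and $$\eta(q)=\frac{M_{21}(q)M_{32}(q)M_{13}(q)}{M_{31}(q)M_{23}(q)M_{12}(q)},\quad b_1(q)=\frac{M_{21}(q)M_{13}(q)}{M_{11}(q)M_{23}(q)},\quad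 b_2(q)=\frac{M_{22}(q)M_{13}(q)}{M_{12}(q)M_{23}(q)},\quad b_3(q)=\frac{M_{33}(q)M_{12}(q)}{M_{13}(q)M_{32}(q)},$$ rational functions in the LECs, and $\mathcal S^{(0)}=\{1,\ \eta(0),\ \eta(0)+1,\ \eta(0)/(\eta(0)+1)\}$. Assume that the min-cut between $S_i$ and $T_j$ is non-zero for all $i,j$ and that $\eta(0)$ is not a constant. **Time-invariant scheme.** Let $n=2n'+1$, let $\alpha\in\mathbb F_{2^m}$ have order $n$, let $\hat M_{ij}=\mathrm{diag}(M_{ij}(0),\dots,M_{ij}(n-1))$, $\hat U=\hat M_{12}^{-1}\hat M_{32}\hat M_{31}^{-1}\hat M_{21}\hat M_{23}^{-1}\hat M_{13}$, $\hat R=\hat M_{13}\hat M_{23}^{-1}$, $\hat S=\hat M_{12}\hat M_{32}^{-1}$, let $W$ be the all-ones column, $V_1=[W\ \hat UW\cdots\hat U^{n'}W]$, $V_2=[\hat RW\ \hat R\hat UW\cdots\hat R\hat U^{n'-1}W]$, $V_3=[\hat S\hat UW\cdots\hat S\hat U^{n'}W]$. PBNA using transform approach and time-invariant LECs is *feasible*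 for $n'$ if, for some such $m$ and $\alpha$, the matrices $[V_1\ \hat M_{11}^{-1}\hat M_{21}V_2]$, $[\hat M_{12}^{-1}\hat M_{22}V_2\ V_1]$, $[\hat M_{13}^{-1}\hat M_{33}V_3\ V_1]$ have rank $2n'+1$ over $\mathbb F_{2^m}(\underline\varepsilon)$. It is *feasible with arbitrary precoding* for $n'$ if there are $m$, $\alpha\in\mathbb F_{2^m}$ of order $n$, LECs in $\mathbb F_{2^m}$ making all $\hat M_{ij}$ invertible, and matrices $V_1,V_2,V_3$ over $\mathbb F_{2^m}$ with $n$ rows and $n'+1,n',n'$ columns, such that each $T_j$ can recover $X'_j$ from $\sum_i\hat M_{ij}V_iX'_i$. **Block time-varying scheme.** For block length $k$, with LECs $\underline\varepsilon_l$ in block $l$, put $M_{ij}^q=\mathrm{diag}(M_{ij}(\underline\varepsilon_1,\alpha^q),\dots,M_{ij}(\underline\varepsilon_{2n'+1},\alpha^q))$. The scheme is *feasible* if for every $n'>1$ there are $m$, $\alpha\in\mathbb F_{2^m}$ of order $k$, and $\underline\varepsilon_1,\dots,\underline\varepsilon_{2n'+1}$ in $\mathbb F_{2^m}$ such that for each $q=1,\dots,k-1$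 all $M_{ij}^q$ are invertible and, for some matrices $V_i^{(q)}$ over $\mathbb F_{2^m}$ (with $2n'+1$ rows and $n'+1,n',n'$ columns), each $T_j$ can recover $X_j'(q)$ from $\sum_iM_{ij}^qV_i^{(q)}X'_i(q)$. **Proposition.** 1. If $b_i(0)\in\mathcal S^{(0)}$ for some $i\in\{1,2,3\}$, then for every $n'>1$ PBNA using transform approach and time-invariant LECs is infeasible, and it is infeasible even with arbitrary precoding. 2. For every odd $k>1$: if PBNA using transform approach and block time-varying LECs with block length $k$ is infeasible, then for every $n'>1$ PBNA using transform approach and time-invariant LECs is infeasible, and it is infeasible even with arbitrary precoding. -/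

import Mathlib

open scoped BigOperators Matrix

noncomputable section

/-- A three-source three-destination multiple unicast network with delays: a directed acyclic
multigraph with node set `V` and link set `E`, every link having unit delay and carrying one field
symbol per use.  Source `i` generates one process, which destination `i` demands.  The sources
and destinations `1, 2, 3` are indexed by `0, 1, 2 : Fin 3`. -/
structure UnicastNetwork (V E : Type*) where
  tail : E → V
  head : E → V
  source : Fin 3 → V
  sink : Fin 3 → V
  acyclic : ∀ v, ¬ Relation.TransGen (fun u w => ∃ e, tail e = u ∧ head e = w) v v

namespace UnicastNetwork

variable {V E : Type*}

/-- The index set of the local encoding coefficients (LECs): `α_{i,e}` for a link `e` leaving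
source `i`, `β_{e',e}` for a link `e` leaving the node that the link `e'` enters, and `ε_{e,j}`
for a link `e` entering destination `j`.  An assignment of the LECs in `R` is a map `N.LEC → R`. -/
inductive LEC (N : UnicastNetwork V E) : Type _
  | inp (i : Fin 3) (e : E) (h : N.tail e = N.source i) : LEC N
  | mid (e' e : E) (h : N.head e' = N.tail e) : LEC N
  | out (e : E) (j : Fin 3) (h : N.head e = N.sink j) : LEC N

/-- `C` separates destination `j` from source `i`. -/
def IsCut (N : UnicastNetwork V E) (i j : Fin 3) (C : Finset E) : Prop :=
  ¬ Relation.TransGen (fun u w => ∃ e, e ∉ C ∧ N.tail e = u ∧ N.head e = w)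
    (N.source i) (N.sink j)

/-- The min-cut between source `i` and destination `j`. -/
def minCut (N : UnicastNetwork V E) (i j : Fin 3) : ℕ :=
  sInf {c | ∃ C : Finset E, C.card = c ∧ N.IsCut i j C}

variable [DecidableEq V] [Fintype E]

/-- `Z^{(t)}(e)`, the symbol on link `e` at time `t` when source `i` emits `x i t` at time `t ≥ 0`
and the time-invariant LECs are `ε`:
`Z^{(t+1)}(e) = ∑_i α_{i,e} X_i^{(t)} + ∑_{head e' = tail e} β_{e',e} Z^{(t)}(e')`. -/
def linkSymbol (N : UnicastNetwork V E) {R : Type*} [CommRing R] (ε : N.LEC → R)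
    (x : Fin 3 → ℕ → R) : ℕ → E → R
  | 0, _ => 0
  | t + 1, e =>
      (∑ i, if h : N.tail e = N.source i then ε (LEC.inp i e h) * x i t else 0) +
        ∑ e', if h : N.head e' = N.tail e then ε (LEC.mid e' e h) * linkSymbol N ε x t e' else 0

/-- `Y_j^{(t)}`, the output at destination `j` at time `t`:
`Y_j^{(t+1)} = ∑_{head e = T_j} ε_{e,j} Z^{(t)}(e)`. -/
def output (N : UnicastNetwork V E) {R : Type*} [CommRing R] (ε : N.LEC → R)
    (x : Fin 3 → ℕ → R) (j : Fin 3) : ℕ → R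
  | 0 => 0
  | t + 1 => ∑ e, if h : N.head e = N.sink j then
      ε (LEC.out e j h) * N.linkSymbol ε x t e else 0

/-- `M_{ij}^{(d)}`, the output of destination `j` at time `d` when source `i` emits `1` at time `0`
and nothing else is emitted. -/
def transferCoeff (N : UnicastNetwork V E) {R : Type*} [CommRing R] (ε : N.LEC → R)
    (i j : Fin 3) (d : ℕ) : R :=
  N.output ε (fun i' t => if i' = i ∧ t = 0 then 1 else 0) j d

/-- The transfer function `M_{ij}(ε, D) = ∑_d M_{ij}^{(d)} D^d` from source `i` to destination `j`.
As the network is acyclic, a path has at most `|E|` links and delay at most `|E| + 1`, so no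
further terms occur. -/
def transfer (N : UnicastNetwork V E) {R : Type*} [CommRing R] (ε : N.LEC → R) (D : R)
    (i j : Fin 3) : R :=
  ∑ d ∈ Finset.range (Fintype.card E + 2), N.transferCoeff ε i j d * D ^ d

/-- `η` as a function of the LECs, at the value `D` of the delay parameter. -/
def eta (N : UnicastNetwork V E) {K : Type*} [Field K] (ε : N.LEC → K) (D : K) : K :=
  let M := N.transfer ε D
  (M 1 0 * M 2 1 * M 0 2) / (M 2 0 * M 1 2 * M 0 1)

/-- `b_1, b_2, b_3` as functions of the LECs, at the value `D` of the delay parameter. -/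
def b (N : UnicastNetwork V E) {K : Type*} [Field K] (ε : N.LEC → K) (D : K) : Fin 3 → K :=
  let M := N.transfer ε D
  ![(M 1 0 * M 0 2) / (M 0 0 * M 1 2),
    (M 1 1 * M 0 2) / (M 0 1 * M 1 2),
    (M 2 2 * M 0 1) / (M 0 2 * M 2 1)]

/-- The field `F(ε)` of rational functions over `F` in the LECs. -/
abbrev RatLEC (N : UnicastNetwork V E) (F : Type*) [Field F] : Type _ :=
  FractionRing (MvPolynomial N.LEC F)

/-- The constant `c : F` as an element of `F(ε)`. -/
def const (N : UnicastNetwork V E) {F : Type*} [Field F] (c : F) : N.RatLEC F :=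
  algebraMap (MvPolynomial N.LEC F) (N.RatLEC F) (MvPolynomial.C c)

/-- The LECs as indeterminates. -/
def indet (N : UnicastNetwork V E) (F : Type*) [Field F] : N.LEC → N.RatLEC F :=
  fun s => algebraMap (MvPolynomial N.LEC F) (N.RatLEC F) (MvPolynomial.X s)

/-- `η(q)`, a rational function in the LECs (`a` is the DFT parameter). -/
def etaAt (N : UnicastNetwork V E) {F : Type*} [Field F] (a : F) (q : ℕ) : N.RatLEC F :=
  N.eta (N.indet F) (N.const (a ^ q))

/-- `b_i(q)`, a rational function in the LECs (`a` is the DFT parameter). -/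
def bAt (N : UnicastNetwork V E) {F : Type*} [Field F] (a : F) (q : ℕ) (i : Fin 3) :
    N.RatLEC F :=
  N.b (N.indet F) (N.const (a ^ q)) i

/-- The set `S^{(q)} = {1, η(q), η(q) + 1, η(q) / (η(q) + 1)}`. -/
def exceptional (N : UnicastNetwork V E) {F : Type*} [Field F] (a : F) (q : ℕ) :
    Set (N.RatLEC F) :=
  {1, N.etaAt a q, N.etaAt a q + 1, N.etaAt a q / (N.etaAt a q + 1)}

/-- Destination `j` can recover its own symbols: some decoding map returns `x j` from
`∑_i H_{ij} V_i x_i`, whatever the independent symbols `x_1, x_2, x_3` are. -/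
def Recoverable {K : Type*} [Field K] {n : ℕ} {len : Fin 3 → ℕ}
    (H : Fin 3 → Fin 3 → Matrix (Fin n) (Fin n) K) (W : ∀ i, Matrix (Fin n) (Fin (len i)) K)
    (j : Fin 3) : Prop :=
  ∃ dec : (Fin n → K) → (Fin (len j) → K),
    ∀ x : (∀ i, Fin (len i) → K), dec (∑ i, H i j *ᵥ (W i *ᵥ x i)) = x j

/-- The numbers `n' + 1, n', n'` of independent symbols of the three sources. -/
def lens (n' : ℕ) : Fin 3 → ℕ := ![n' + 1, n', n']

/-! ### Transform approach, time-invariant LECs -/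

/-- `M̂_{ij} = diag (M_{ij}(ε, 1), M_{ij}(ε, a), …, M_{ij}(ε, a^{n-1}))`. -/
def hatM (N : UnicastNetwork V E) {K : Type*} [Field K] (ε : N.LEC → K) (a : K) (n : ℕ)
    (i j : Fin 3) : Matrix (Fin n) (Fin n) K :=
  Matrix.diagonal fun q : Fin n => N.transfer ε (a ^ (q : ℕ)) i j

/-- `Û = M̂₁₂⁻¹ M̂₃₂ M̂₃₁⁻¹ M̂₂₁ M̂₂₃⁻¹ M̂₁₃`. -/
def hatU (N : UnicastNetwork V E) {K : Type*} [Field K] (ε : N.LEC → K) (a : K) (n : ℕ) :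
    Matrix (Fin n) (Fin n) K :=
  let M := N.hatM ε a n
  (M 0 1)⁻¹ * M 2 1 * (M 2 0)⁻¹ * M 1 0 * (M 1 2)⁻¹ * M 0 2

/-- `R̂ = M̂₁₃ M̂₂₃⁻¹`. -/
def hatR (N : UnicastNetwork V E) {K : Type*} [Field K] (ε : N.LEC → K) (a : K) (n : ℕ) :
    Matrix (Fin n) (Fin n) K :=
  N.hatM ε a n 0 2 * (N.hatM ε a n 1 2)⁻¹

/-- `Ŝ = M̂₁₂ M̂₃₂⁻¹`. -/
def hatS (N : UnicastNetwork V E) {K : Type*} [Field K] (ε : N.LEC → K) (a : K) (n : ℕ) :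
    Matrix (Fin n) (Fin n) K :=
  N.hatM ε a n 0 1 * (N.hatM ε a n 2 1)⁻¹

/-- `V₁ = [W, Û W, …, Û^{n'} W]`, with `W` the all-ones column. -/
def V₁ (N : UnicastNetwork V E) {K : Type*} [Field K] (ε : N.LEC → K) (a : K) (n' : ℕ) :
    Matrix (Fin (2 * n' + 1)) (Fin (n' + 1)) K :=
  Matrix.of fun r c => (N.hatU ε a (2 * n' + 1) ^ (c : ℕ) *ᵥ 1) r

/-- `V₂ = [R̂ W, R̂ Û W, …, R̂ Û^{n'-1} W]`. -/
def V₂ (N : UnicastNetwork V E) {K : Type*} [Field K] (ε : N.LEC → K) (a : K) (n' : ℕ) :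
    Matrix (Fin (2 * n' + 1)) (Fin n') K :=
  Matrix.of fun r c =>
    ((N.hatR ε a (2 * n' + 1) * N.hatU ε a (2 * n' + 1) ^ (c : ℕ)) *ᵥ 1) r

/-- `V₃ = [Ŝ Û W, Ŝ Û² W, …, Ŝ Û^{n'} W]`. -/
def V₃ (N : UnicastNetwork V E) {K : Type*} [Field K] (ε : N.LEC → K) (a : K) (n' : ℕ) :
    Matrix (Fin (2 * n' + 1)) (Fin n') K :=
  Matrix.of fun r c =>
    ((N.hatS ε a (2 * n' + 1) * N.hatU ε a (2 * n' + 1) ^ ((c : ℕ) + 1)) *ᵥ 1) r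

/-- The three rank conditions for the precoding matrices `V₁, V₂, V₃`. -/
def RankConditions (N : UnicastNetwork V E) {K : Type*} [Field K] (ε : N.LEC → K) (a : K)
    (n' : ℕ) : Prop :=
  let M := N.hatM ε a (2 * n' + 1)
  (Matrix.fromCols (N.V₁ ε a n') ((M 0 0)⁻¹ * M 1 0 * N.V₂ ε a n')).rank = 2 * n' + 1 ∧
  (Matrix.fromCols ((M 0 1)⁻¹ * M 1 1 * N.V₂ ε a n') (N.V₁ ε a n')).rank = 2 * n' + 1 ∧
  (Matrix.fromCols ((M 0 2)⁻¹ * M 2 2 * N.V₃ ε a n') (N.V₁ ε a n')).rank = 2 * n' + 1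

/-- PBNA using transform approach and time-invariant LECs over `2n' + 1` symbol extensions is
feasible: for some field `𝔽_{2^m}` and some DFT parameter `a` of order `2n' + 1` in it, the rank
conditions hold over the field of rational functions in the LECs. -/
def TimeInvariantFeasible (N : UnicastNetwork V E) (n' : ℕ) : Prop :=
  ∃ m : ℕ, m ≠ 0 ∧ ∃ a : GaloisField 2 m, IsPrimitiveRoot a (2 * n' + 1) ∧
    N.RankConditions (N.indet (GaloisField 2 m)) (N.const a) n'

/-- The scheme is feasible for some choice of the precoding matrices: there are a field `𝔽_{2^m}`,
a DFT parameter of order `2n' + 1`, time-invariant LECs that make all `M̂_{ij}` invertible, and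
arbitrary precoding matrices, such that every destination can recover its symbols. -/
def TimeInvariantFeasibleAny (N : UnicastNetwork V E) (n' : ℕ) : Prop :=
  ∃ m : ℕ, m ≠ 0 ∧ ∃ a : GaloisField 2 m, IsPrimitiveRoot a (2 * n' + 1) ∧
    ∃ ε : N.LEC → GaloisField 2 m,
      (∀ i j, IsUnit (N.hatM ε a (2 * n' + 1) i j)) ∧
      ∃ W : ∀ i, Matrix (Fin (2 * n' + 1)) (Fin (lens n' i)) (GaloisField 2 m),
        ∀ j, Recoverable (N.hatM ε a (2 * n' + 1)) W j

/-! ### Transform approach, block time-varying LECs -/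

/-- `M_{ij}^q = diag (M_{ij}(ε_1, a^q), …, M_{ij}(ε_n, a^q))`, where the LECs are `ε_l` during the
transmission of block `l`. -/
def blockM (N : UnicastNetwork V E) {K : Type*} [Field K] {n : ℕ} (ε : Fin n → N.LEC → K)
    (a : K) (q : ℕ) (i j : Fin 3) : Matrix (Fin n) (Fin n) K :=
  Matrix.diagonal fun l : Fin n => N.transfer (ε l) (a ^ q) i j

/-- PBNA using transform approach and block time-varying LECs, with blocks of length `k`, is
feasible: for every `n' > 1` there are a field `𝔽_{2^m}`, a DFT parameter of order `k`, and LECs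
for the `2n' + 1` blocks such that for `q = 1, …, k - 1` the matrices `M_{ij}^q` are invertible and,
with suitable precoding matrices, every destination recovers its `q`-th block of symbols. -/
def BlockTimeVaryingFeasible (N : UnicastNetwork V E) (k : ℕ) : Prop :=
  ∀ n' : ℕ, 1 < n' →
    ∃ m : ℕ, m ≠ 0 ∧ ∃ a : GaloisField 2 m, IsPrimitiveRoot a k ∧
      ∃ ε : Fin (2 * n' + 1) → N.LEC → GaloisField 2 m,
        ∀ q : ℕ, 1 ≤ q → q < k →
          (∀ i j, IsUnit (N.blockM ε a q i j)) ∧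
          ∃ W : ∀ i, Matrix (Fin (2 * n' + 1)) (Fin (lens n' i)) (GaloisField 2 m),
            ∀ j, Recoverable (N.blockM ε a q) W j

end UnicastNetwork

end

/-! Everything hinges on one dichotomy. Let `K` be the algebraic closure of `𝔽₂`. Either some `b_i`
equals `γ(η)/δ(η)` with `γ`, `δ` coprime of degree at most one over `K`
(`FractionalLinearRelation`), or no `b_i` is a rational function of `η` over `K` at all. A path has
as many LECs as its delay, so `M(ε, D) = M(Dε, 1)`; statements at `D = 1` therefore transfer to
every `α^q`.

The middle ground is excluded by `fractionalLinearRelation_of_aeval_eq`. Each `b_i` is a cross ratio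
of path sums in an acyclic graph, hence `1` or a nonconstant fractional linear function of one LEC
(`crossRatio_fractionalLinear`). In the second case that LEC can be replaced so that `b_i` becomes a
free variable `X`. A relation `f(η) = b_i g(η)` with `f`, `g` coprime then reads `f(y) = X g(y)`
with `y` rational in `X`, which forces degree at most one.

If a relation holds, `not_recoverable` defeats every precoding over diagonal channels. Decodability
forces interference alignment by a dimension count; alignment yields a nonzero vector `y` of the
second precoding space with `ηy` again in it, and the relation turns `y` into a signal that
interference cancels at destination `i`. The four members of the exceptional set are fractional
linear in `η`, which gives the first claim.

If no relation holds, the columns of the three decoding matrices are linearly independent families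
of polynomials, so `2n' + 1` generic LEC vectors keep them independent for all `q` at once
(`blockTimeVaryingFeasible`). Time-invariant feasibility excludes all relations, so it implies block
time-varying feasibility: the second claim in contrapositive form. -/

noncomputable section

/-! ### Gauss's lemma and fractional linear transformations -/

section Univariate

open Polynomial

/-- If `f / g` in lowest terms, evaluated at a rational function, is the identity function, then
`f / g` is a fractional linear transformation. -/
theorem natDegree_le_one_of_aeval_eq_X_mul {L : Type*} [Field L] {f g : L[X]} (hfg : IsCoprime f g)
    {y : RatFunc L} (h : aeval y f = RatFunc.X * aeval y g) :
    f.natDegree ≤ 1 ∧ g.natDegree ≤ 1 := by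
  have hg0 : g ≠ 0 := by
    rintro rfl
    rw [isCoprime_zero_right] at hfg
    rw [map_zero, mul_zero] at h
    exact (hfg.map (aeval y)).ne_zero h
  -- With the variables swapped, `Φ` is linear with coprime coefficients, hence irreducible. Gauss's
  -- lemma carries this to the rational function field, where `y` is a root; so `Φ` has degree one.
  set Φ : L[X][X] := f.map C - C X * g.map C with hΦ
  have hcoeff : ∀ n, Φ.coeff n = C (f.coeff n) - X * C (g.coeff n) := fun n ↦ by simp [hΦ]
  -- `f_n - X g_n` vanishes only if `f_n` and `g_n` both do, so nothing cancels in `Φ`.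
  have hdeg : ∀ n, f.coeff n ≠ 0 ∨ g.coeff n ≠ 0 → n ≤ Φ.natDegree := by
    intro n hn
    refine le_natDegree_of_ne_zero fun h0 ↦ ?_
    rw [hcoeff] at h0
    have h1 := congrArg (fun p ↦ p.coeff 0) h0
    have h2 := congrArg (fun p ↦ p.coeff 1) h0
    simp [coeff_C] at h1 h2
    tauto
  have hirr : Irreducible Φ := by
    have hsw : Bivariate.swap (C f - X * C g) = Φ := by
      rw [map_sub, map_mul, Bivariate.swap_C, Bivariate.swap_C, Bivariate.swap_Y]
    rw [← hsw, MulEquiv.irreducible_iff]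
    apply irreducible_of_degree_eq_one_of_isRelPrime_coeff
    · have : C f - X * C g = C (-g) * X + C f := by rw [C_neg]; ring
      rw [this, degree_linear (neg_ne_zero.mpr hg0)]
    · simpa using hfg.isRelPrime.neg_right
  have key : Φ.natDegree ≤ 1 := by
    by_cases h0 : Φ.natDegree = 0
    · omega
    have hprim := hirr.isPrimitive h0
    have hirr' := (hprim.irreducible_iff_irreducible_map_fraction_map (K := RatFunc L)).mp hirr
    have hroot : (Φ.map (algebraMap L[X] (RatFunc L))).IsRoot y := by
      rw [IsRoot, eval_map_algebraMap, hΦ, map_sub, map_mul, aeval_C]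
      have hm : ∀ p : L[X], aeval y (p.map (C : L →+* L[X])) = aeval y p := fun p ↦ by
        rw [← algebraMap_eq, aeval_map_algebraMap]
      rw [hm, hm, h, RatFunc.algebraMap_X, sub_self]
    have := degree_eq_one_of_irreducible_of_root hirr' hroot
    rw [degree_map_eq_of_injective (IsFractionRing.injective _ _)] at this
    exact (natDegree_eq_of_degree_eq_some this).le
  constructor
  · by_cases hf : f = 0
    · simp [hf]
    · exact (hdeg _ (.inl (by simpa using hf))).trans key
  · exact (hdeg _ (.inr (by simpa using hg0))).trans key

end Univariate

/-! ### Path sums of acyclic graphs and their cross ratios -/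

section PathSum

open Finset MvPolynomial

variable {A K : Type*} [Field K]

/-- The polynomial `p` does not involve the variable `s`. -/
def FreeOf [DecidableEq A] (s : A) (p : MvPolynomial A K) : Prop :=
  ∀ q : MvPolynomial A K, aeval (Function.update X s q) p = p

/-- `u / v` is a nonconstant fractional linear function of one of the variables. -/
def FractionalLinear [DecidableEq A] (u v : MvPolynomial A K) : Prop :=
  ∃ (s : A) (a b c d : MvPolynomial A K), FreeOf s a ∧ FreeOf s b ∧ FreeOf s c ∧ FreeOf s d ∧
    a * d ≠ b * c ∧ u * (c + X s * d) = v * (a + X s * b)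

theorem FreeOf.mul [DecidableEq A] {s : A} {p q : MvPolynomial A K} (hp : FreeOf s p)
    (hq : FreeOf s q) : FreeOf s (p * q) := fun x ↦ by
  rw [map_mul, hp, hq]

variable {Ω R : Type*} [DecidableEq Ω] [Fintype A] [CommRing R]

/-- The weighted adjacency matrix of the directed multigraph with arcs `s : src s → tgt s` of
weight `ε s`. -/
def arcMatrix (src tgt : A → Ω) (ε : A → R) : Matrix Ω Ω R :=
  Matrix.of fun u w => ∑ s, if src s = u ∧ tgt s = w then ε s else 0

variable {src tgt : A → Ω}

theorem arcMatrix_smul (c : R) (ε : A → R) :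
    arcMatrix src tgt (c • ε) = c • arcMatrix src tgt ε := by
  ext u w
  simp [arcMatrix, mul_sum]

variable [Fintype Ω]

/-- The sum of the weights of all paths with fewer than `n` arcs. -/
def pathSum (src tgt : A → Ω) (n : ℕ) (ε : A → R) : Matrix Ω Ω R :=
  ∑ d ∈ range n, arcMatrix src tgt ε ^ d

theorem arcMatrix_mul_apply (ε : A → R) (M : Matrix Ω Ω R) (u w : Ω) :
    (arcMatrix src tgt ε * M) u w = ∑ s, if src s = u then ε s * M (tgt s) w else 0 := by
  simp only [Matrix.mul_apply, arcMatrix, Matrix.of_apply, sum_mul]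
  rw [sum_comm]
  refine sum_congr rfl fun s _ ↦ ?_
  by_cases h : src s = u <;> simp [h]

theorem mul_arcMatrix_apply (ε : A → R) (M : Matrix Ω Ω R) (u w : Ω) :
    (M * arcMatrix src tgt ε) u w = ∑ s, if tgt s = w then ε s * M u (src s) else 0 := by
  simp only [Matrix.mul_apply, arcMatrix, Matrix.of_apply, mul_sum]
  rw [sum_comm]
  refine sum_congr rfl fun s _ ↦ ?_
  by_cases h : tgt s = w <;> simp [h, mul_comm]

variable {r : Ω → ℕ}

theorem arcMatrix_pow_apply_eq_zero (hr : ∀ s, r (src s) < r (tgt s)) (ε : A → R) (d : ℕ) :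
    ∀ u w, r w < r u + d → (arcMatrix src tgt ε ^ d) u w = 0 := by
  induction d with
  | zero =>
    intro u w h
    rw [pow_zero, Matrix.one_apply_ne]
    rintro rfl
    omega
  | succ d ih =>
    intro u w h
    rw [pow_succ', arcMatrix_mul_apply]
    refine sum_eq_zero fun s _ ↦ ?_
    split_ifs with hs
    · have := hr s
      rw [hs] at this
      rw [ih _ _ (by omega), mul_zero]
    · rfl

/-- A path is empty or has a first arc. The geometric sum closes up because ranks increase along
arcs and stay below `n`, so there is no path with `n` arcs. -/
theorem pathSum_apply {n : ℕ} (hr : ∀ s, r (src s) < r (tgt s)) (hn : ∀ u, r u < n) (ε : A → R)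
    (u w : Ω) : pathSum src tgt n ε u w = (1 : Matrix Ω Ω R) u w +
      ∑ s, if src s = u then ε s * pathSum src tgt n ε (tgt s) w else 0 := by
  have h : pathSum src tgt n ε + arcMatrix src tgt ε ^ n =
      1 + arcMatrix src tgt ε * pathSum src tgt n ε := by
    rw [pathSum, ← sum_range_succ, sum_range_succ', mul_sum, pow_zero, add_comm]
    simp only [pow_succ']
  have h0 : (arcMatrix src tgt ε ^ n) u w = 0 :=
    arcMatrix_pow_apply_eq_zero hr ε n u w (by have := hn w; omega)
  have := congrFun (congrFun h u) w
  rwa [Matrix.add_apply, Matrix.add_apply, h0, add_zero, arcMatrix_mul_apply] at this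

theorem map_pathSum {S : Type*} [CommRing S] (φ : R →+* S) (n : ℕ) (ε : A → R) (u w : Ω) :
    φ (pathSum src tgt n ε u w) = pathSum src tgt n (φ ∘ ε) u w := by
  have h1 : φ.mapMatrix (arcMatrix src tgt ε) = arcMatrix src tgt (φ ∘ ε) := by
    ext u w
    simp [arcMatrix, map_sum, apply_ite φ]
  have h2 : φ.mapMatrix (pathSum src tgt n ε) = pathSum src tgt n (φ ∘ ε) := by
    simp only [pathSum, map_sum, map_pow, h1]
  rw [← h2]
  rfl

/-- The path sums starting at a vertex do not involve the arcs that leave a vertex before it. -/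
theorem pathSum_congr {n : ℕ} (hr : ∀ s, r (src s) < r (tgt s)) (hn : ∀ u, r u < n) {ε ε' : A → R}
    {u : Ω} (h : ∀ s, src s ≠ u → ε s = ε' s) (w : Ω) :
    ∀ v, v ≠ u → r u ≤ r v → pathSum src tgt n ε v w = pathSum src tgt n ε' v w := by
  suffices H : ∀ k v, n - r v ≤ k → v ≠ u → r u ≤ r v →
      pathSum src tgt n ε v w = pathSum src tgt n ε' v w from fun v ↦ H _ v le_rfl
  intro k
  induction k with
  | zero => intro v hv; have := hn v; omega
  | succ k ih =>
    intro v hv hvu huv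
    rw [pathSum_apply hr hn, pathSum_apply hr hn]
    congr 1
    refine sum_congr rfl fun s _ ↦ ?_
    split_ifs with hs
    · have h1 := hr s
      have h2 := hn (tgt s)
      rw [hs] at h1
      rw [h s (by rwa [hs]), ih (tgt s) (by omega) (by rintro h; rw [h] at h1; omega) (by omega)]
    · rfl

/-- A path from `v` can never reach `src s`, since the rank would have to drop. -/
theorem freeOf_pathSum [DecidableEq A] {n : ℕ} (hr : ∀ s, r (src s) < r (tgt s))
    (hn : ∀ u, r u < n) {s : A} {v : Ω} (hv : v ≠ src s) (hsv : r (src s) ≤ r v) (w : Ω) :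
    FreeOf s (pathSum src tgt n (X : A → MvPolynomial A K) v w) := by
  intro q
  have := map_pathSum (src := src) (tgt := tgt)
    (aeval (Function.update X s q) : MvPolynomial A K →ₐ[K] MvPolynomial A K).toRingHom n X v w
  refine this.trans (pathSum_congr hr hn (u := src s) (fun s' hs' ↦ ?_) w v hv hsv)
  have : s' ≠ s := by rintro rfl; exact hs' rfl
  simp [this]

/-- The difference counts the paths that do not begin with `s`, and no path returns to `src s`. Thus
path sums from `src s` are affine in `X s`. -/
theorem freeOf_pathSum_sub [DecidableEq A] {n : ℕ} (hr : ∀ s, r (src s) < r (tgt s))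
    (hn : ∀ u, r u < n) (s : A) (w : Ω) :
    FreeOf s (pathSum src tgt n (X : A → MvPolynomial A K) (src s) w -
      X s * pathSum src tgt n X (tgt s) w) := by
  have hfree : ∀ s', src s' = src s →
      FreeOf s (pathSum src tgt n (X : A → MvPolynomial A K) (tgt s') w) := fun s' hs' ↦ by
    have := hr s'
    rw [hs'] at this
    exact freeOf_pathSum hr hn (by rintro h; rw [h] at this; omega) this.le w
  have heq : pathSum src tgt n (X : A → MvPolynomial A K) (src s) w -
      X s * pathSum src tgt n X (tgt s) w = (1 : Matrix Ω Ω (MvPolynomial A K)) (src s) w +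
      ∑ s' ∈ univ.erase s, if src s' = src s then X s' * pathSum src tgt n X (tgt s') w else 0 := by
    rw [pathSum_apply hr hn, ← add_sum_erase univ _ (mem_univ s), if_pos rfl]
    ring
  rw [heq]
  intro q
  rw [map_add, map_sum]
  congr 1
  · by_cases h : src s = w <;> simp [Matrix.one_apply, h]
  · refine sum_congr rfl fun s' hs' ↦ ?_
    split_ifs with h
    · rw [map_mul, hfree s' h, aeval_X, Function.update_of_ne (ne_of_mem_erase hs')]
    · rw [map_zero]

/-- The vertex of smaller rank is moved. If some arc `s` out of `u₁` changes the ratio of the values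
at `w₁` and `w₂`, the cross ratio is fractional linear and nonconstant in `X s`. If no arc does,
`u₁` may be replaced by the end of any arc leading on to `w₁`. If there is no such arc, only empty
paths remain and `u₁ = w₁ = w₂`. -/
theorem crossRatio_step [DecidableEq A] {n : ℕ} (hr : ∀ s, r (src s) < r (tgt s))
    (hn : ∀ u, r u < n) {w₁ w₂ u₁ u₂ : Ω} (g : Matrix Ω Ω (MvPolynomial A K))
    (hg : g = pathSum src tgt n X)
    (h₁₁ : g u₁ w₁ ≠ 0) (h₁₂ : g u₁ w₂ ≠ 0) (h₂₁ : g u₂ w₁ ≠ 0) (h₂₂ : g u₂ w₂ ≠ 0)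
    (hu : r u₁ ≤ r u₂)
    (ih : ∀ s, src s = u₁ → g (tgt s) w₁ ≠ 0 → g (tgt s) w₂ ≠ 0 →
      g (tgt s) w₁ * g u₂ w₂ = g (tgt s) w₂ * g u₂ w₁ ∨
        FractionalLinear (g (tgt s) w₁ * g u₂ w₂) (g (tgt s) w₂ * g u₂ w₁)) :
    g u₁ w₁ * g u₂ w₂ = g u₁ w₂ * g u₂ w₁ ∨
      FractionalLinear (g u₁ w₁ * g u₂ w₂) (g u₁ w₂ * g u₂ w₁) := by
  by_cases hu12 : u₂ = u₁
  · subst hu12; left; ring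
  by_cases hs : ∃ s, src s = u₁ ∧ g u₁ w₁ * g (tgt s) w₂ ≠ g u₁ w₂ * g (tgt s) w₁
  · right
    obtain ⟨s, rfl, hs⟩ := hs
    have ht : ∀ w, FreeOf s (g (tgt s) w) := fun w ↦ by
      have := hr s
      rw [hg]
      exact freeOf_pathSum hr hn (by rintro h; rw [h] at this; omega) this.le w
    have h2 : ∀ w, FreeOf s (g u₂ w) := fun w ↦ hg ▸ freeOf_pathSum hr hn hu12 hu w
    have h1 : ∀ w, FreeOf s (g (src s) w - X s * g (tgt s) w) := fun w ↦
      hg ▸ freeOf_pathSum_sub hr hn s w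
    refine ⟨s, (g (src s) w₁ - X s * g (tgt s) w₁) * g u₂ w₂, g (tgt s) w₁ * g u₂ w₂,
      (g (src s) w₂ - X s * g (tgt s) w₂) * g u₂ w₁, g (tgt s) w₂ * g u₂ w₁, (h1 _).mul (h2 _),
      (ht _).mul (h2 _), (h1 _).mul (h2 _), (ht _).mul (h2 _), fun h ↦ hs ?_, by ring⟩
    exact mul_right_cancel₀ (mul_ne_zero h₂₁ h₂₂) (by linear_combination h)
  push Not at hs
  by_cases hs1 : ∃ s, src s = u₁ ∧ g (tgt s) w₁ ≠ 0
  · obtain ⟨s, hsu, hs1⟩ := hs1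
    have hcross := hs s hsu
    have hs2 : g (tgt s) w₂ ≠ 0 := by
      intro h
      rw [h, mul_zero, eq_comm] at hcross
      exact mul_ne_zero h₁₂ hs1 hcross
    rcases ih s hsu hs1 hs2 with h | ⟨x, a, b, c, d, ha, hb, hc, hd, hne, h⟩
    · left
      exact mul_right_cancel₀ hs1
        (by linear_combination g u₁ w₁ * h + g u₂ w₁ * hcross)
    · right
      refine ⟨x, a, b, c, d, ha, hb, hc, hd, hne, mul_right_cancel₀ hs1 ?_⟩
      linear_combination g u₁ w₁ * h + g u₂ w₁ * (a + X x * b) * hcross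
  · push Not at hs1
    have hend : ∀ w, (∀ s, src s = u₁ → g (tgt s) w = 0) → g u₁ w ≠ 0 → u₁ = w := by
      intro w hw h
      by_contra hne
      apply h
      rw [hg, pathSum_apply hr hn, Matrix.one_apply_ne hne, zero_add]
      refine sum_eq_zero fun s _ ↦ ?_
      split_ifs with hsu
      · rw [← hg, hw s hsu, mul_zero]
      · rfl
    have e1 := hend w₁ hs1 h₁₁
    have e2 := hend w₂ (fun s hsu ↦ by
      have := hs s hsu
      rw [hs1 s hsu, mul_zero] at this
      exact (mul_eq_zero.mp this).resolve_left h₁₁) h₁₂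
    left
    rw [← e1, ← e2]

/-- A cross ratio of path sums of an acyclic graph is either `1` or a nonconstant fractional linear
function of the weight of some arc. -/
theorem crossRatio_fractionalLinear [DecidableEq A] {n : ℕ} (hr : ∀ s, r (src s) < r (tgt s))
    (hn : ∀ u, r u < n) {w₁ w₂ : Ω} (g : Matrix Ω Ω (MvPolynomial A K))
    (hg : g = pathSum src tgt n X) :
    ∀ u₁ u₂, g u₁ w₁ ≠ 0 → g u₁ w₂ ≠ 0 → g u₂ w₁ ≠ 0 → g u₂ w₂ ≠ 0 →
    (g u₁ w₁ * g u₂ w₂ = g u₁ w₂ * g u₂ w₁ ∨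
      FractionalLinear (g u₁ w₁ * g u₂ w₂) (g u₁ w₂ * g u₂ w₁)) := by
  suffices H : ∀ k u₁ u₂, (n - r u₁) + (n - r u₂) ≤ k →
      g u₁ w₁ ≠ 0 → g u₁ w₂ ≠ 0 → g u₂ w₁ ≠ 0 → g u₂ w₂ ≠ 0 →
      (g u₁ w₁ * g u₂ w₂ = g u₁ w₂ * g u₂ w₁ ∨
        FractionalLinear (g u₁ w₁ * g u₂ w₂) (g u₁ w₂ * g u₂ w₁)) from
    fun u₁ u₂ ↦ H _ u₁ u₂ le_rfl
  intro k
  induction k with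
  | zero => intro u₁ u₂ h; have := hn u₁; omega
  | succ k ih =>
    intro u₁ u₂ hk h₁₁ h₁₂ h₂₁ h₂₂
    rcases le_total (r u₁) (r u₂) with hu | hu
    · refine crossRatio_step hr hn g hg h₁₁ h₁₂ h₂₁ h₂₂ hu fun s hs h1 h2 ↦ ?_
      have := hr s
      rw [hs] at this
      have := hn (tgt s)
      exact ih _ _ (by omega) h1 h2 h₂₁ h₂₂
    -- The cross ratio is unchanged when `u₁, u₂` and `w₁, w₂` are swapped together.
    · have := crossRatio_step hr hn g hg h₂₂ h₂₁ h₁₂ h₁₁ hu fun s hs h1 h2 ↦ by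
        have := hr s
        rw [hs] at this
        have := hn (tgt s)
        have := ih u₁ (tgt s) (by omega) h₁₁ h₁₂ h2 h1
        rwa [mul_comm (g u₁ w₁), mul_comm (g u₁ w₂)] at this
      rwa [mul_comm (g u₁ w₁), mul_comm (g u₁ w₂)]

end PathSum

/-! ### Turning a cross ratio into a free variable -/

section FractionalLinear

open MvPolynomial

variable {A K : Type*} [DecidableEq A] [Field K]

/-- If `u / v` is a nonconstant fractional linear function of a variable, then this variable may be
replaced in such a way that `u / v` becomes an indeterminate. -/
theorem FractionalLinear.exists_algHom {u v : MvPolynomial A K} (h : FractionalLinear u v)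
    (hv : v ≠ 0) :
    ∃ φ : FractionRing (MvPolynomial A K) →ₐ[K] RatFunc (FractionRing (MvPolynomial A K)),
      φ (algebraMap _ _ u / algebraMap _ _ v) = RatFunc.X := by
  obtain ⟨s, a, b, c, d, ha, hb, hc, hd, hne, h⟩ := h
  set Q := FractionRing (MvPolynomial A K)
  let ι : MvPolynomial A K →ₐ[K] Q := IsScalarTower.toAlgHom K _ _
  have hι : Function.Injective ι := IsFractionRing.injective (MvPolynomial A K) Q
  have hne' : ι a * ι d ≠ ι b * ι c := by
    rw [← map_mul, ← map_mul]
    exact hι.ne hne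
  let κ : Q →ₐ[K] RatFunc Q := IsScalarTower.toAlgHom K _ _
  have hκ : ∀ q, κ q = RatFunc.C q := fun q ↦ rfl
  -- The substitute `x = num / den` for `X s` solves `(a + x b) / (c + x d) = X`.
  set num : Polynomial Q := Polynomial.C (ι c) * Polynomial.X - Polynomial.C (ι a) with hnum
  set den : Polynomial Q := Polynomial.C (ι b) - Polynomial.C (ι d) * Polynomial.X with hden
  have hden0 : den ≠ 0 := by
    intro h0
    have h1 := congrArg (fun p ↦ p.coeff 0) h0
    have h2 := congrArg (fun p ↦ p.coeff 1) h0
    simp [hden, Polynomial.coeff_C] at h1 h2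
    exact hne' (by rw [h1, h2]; ring)
  set x : RatFunc Q := algebraMap _ _ num / algebraMap _ _ den with hx
  have hden0' : algebraMap (Polynomial Q) (RatFunc Q) den ≠ 0 := RatFunc.algebraMap_ne_zero hden0
  have hxden : x * (κ (ι b) - κ (ι d) * RatFunc.X) = κ (ι c) * RatFunc.X - κ (ι a) := by
    have : algebraMap (Polynomial Q) (RatFunc Q) den = κ (ι b) - κ (ι d) * RatFunc.X := by
      simp [hden, hκ]
    rw [← this, hx, div_mul_cancel₀ _ hden0']
    simp [hnum, hκ]
  -- A constant `x` would give `a d = b c`. Transcendence keeps the substitution injective, so that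
  -- it extends to the fraction field.
  have htr : Transcendental Q x := by
    apply RatFunc.transcendental_of_ne_C
    rintro ⟨e, he⟩
    rw [hx, div_eq_iff hden0', ← RatFunc.algebraMap_C, ← map_mul] at he
    have he := RatFunc.algebraMap_injective Q he
    have h1 := congrArg (fun p ↦ p.coeff 0) he
    have h2 := congrArg (fun p ↦ p.coeff 1) he
    simp [hden, hnum, Polynomial.coeff_C] at h1 h2
    exact hne' (by linear_combination (-ι d) * h1 - ι b * h2)
  let ψ : MvPolynomial A K →ₐ[K] Polynomial Q :=
    aeval (Function.update (fun i ↦ Polynomial.C (ι (X i))) s Polynomial.X)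
  have hψ : Function.Injective ψ := by
    have hcomp : ((Polynomial.aeval (ι (X s)) : Polynomial Q →ₐ[Q] Q).restrictScalars K).comp ψ
        = ι := by
      apply MvPolynomial.algHom_ext
      intro i
      by_cases hi : i = s
      · subst hi; simp [ψ]
      · simp [ψ, hi]
    refine Function.Injective.of_comp
      (f := ((Polynomial.aeval (ι (X s)) : Polynomial Q →ₐ[Q] Q).restrictScalars K)) ?_
    rw [← AlgHom.coe_comp, hcomp]
    exact hι
  let φ₀ : MvPolynomial A K →ₐ[K] RatFunc Q :=
    ((Polynomial.aeval x : Polynomial Q →ₐ[Q] RatFunc Q).restrictScalars K).comp ψ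
  have hφ₀ : Function.Injective φ₀ :=
    (transcendental_iff_injective.mp htr).comp hψ
  have hφs : φ₀ (X s) = x := by simp [φ₀, ψ]
  have hfree : ∀ p, FreeOf s p → φ₀ p = κ (ι p) := by
    intro p hp
    have : φ₀.comp (aeval (Function.update X s 0)) =
        (κ.comp ι).comp (aeval (Function.update X s 0)) := by
      apply MvPolynomial.algHom_ext
      intro i
      by_cases hi : i = s
      · subst hi; simp
      · simp [hi, φ₀, ψ, hκ]
    have := DFunLike.congr_fun this p
    simpa only [AlgHom.comp_apply, hp 0] using this
  refine ⟨IsFractionRing.liftAlgHom hφ₀, ?_⟩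
  rw [map_div₀, IsFractionRing.liftAlgHom_apply, IsFractionRing.liftAlgHom_apply,
    IsFractionRing.lift_algebraMap, IsFractionRing.lift_algebraMap]
  change φ₀ u / φ₀ v = RatFunc.X
  have h' := congrArg φ₀ h
  simp only [map_mul, map_add, hφs, hfree _ ha, hfree _ hb, hfree _ hc, hfree _ hd] at h'
  have hcd : κ (ι c) + x * κ (ι d) ≠ 0 := by
    intro h0
    have h1 : κ (ι a * ι d) = κ (ι b * ι c) := by
      rw [map_mul, map_mul]
      linear_combination κ (ι d) * hxden - (κ (ι b) - κ (ι d) * RatFunc.X) * h0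
    exact hne' (κ.toRingHom.injective h1)
  rw [div_eq_iff ((map_ne_zero_iff φ₀ hφ₀).mpr hv)]
  exact mul_right_cancel₀ hcd (by linear_combination h' + φ₀ v * hxden)

/-- If `f(η) = (u / v) g(η)`, where `u / v` is a nonconstant fractional linear function of a variable
and `f`, `g` are coprime, then `f / g` is fractional linear. -/
theorem FractionalLinear.natDegree_le_one {u v : MvPolynomial A K} (h : FractionalLinear u v)
    (hv : v ≠ 0) {f g : Polynomial K} (hfg : IsCoprime f g)
    {y : FractionRing (MvPolynomial A K)}
    (hy : Polynomial.aeval y f = algebraMap _ _ u / algebraMap _ _ v * Polynomial.aeval y g) :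
    f.natDegree ≤ 1 ∧ g.natDegree ≤ 1 := by
  obtain ⟨φ, hφ⟩ := h.exists_algHom hv
  have hy' := congrArg φ hy
  rw [map_mul, hφ, ← Polynomial.aeval_algHom_apply, ← Polynomial.aeval_algHom_apply,
    ← Polynomial.aeval_map_algebraMap (FractionRing (MvPolynomial A K)) _ f,
    ← Polynomial.aeval_map_algebraMap (FractionRing (MvPolynomial A K)) _ g] at hy'
  have := natDegree_le_one_of_aeval_eq_X_mul
    (hfg.map (Polynomial.mapRingHom (algebraMap K (FractionRing (MvPolynomial A K))))) hy'
  simpa [Polynomial.natDegree_map] using this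

end FractionalLinear

/-! ### Transfer functions as path sums -/

namespace UnicastNetwork

open Finset

variable {V E : Type*}

/-- The first vertex of the arc weighted by a LEC, in the graph whose vertices are the source
processes, the links and the outputs. -/
def arcSrc (N : UnicastNetwork V E) : N.LEC → Fin 3 ⊕ E ⊕ Fin 3
  | .inp i _ _ => .inl i
  | .mid e' _ _ => .inr (.inl e')
  | .out e _ _ => .inr (.inl e)

/-- The last vertex of the arc weighted by a LEC. -/
def arcTgt (N : UnicastNetwork V E) : N.LEC → Fin 3 ⊕ E ⊕ Fin 3
  | .inp _ e _ => .inr (.inl e)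
  | .mid _ e _ => .inr (.inl e)
  | .out _ j _ => .inr (.inr j)

theorem arcTgt_eq_link_iff (N : UnicastNetwork V E) (e : E) (s : N.LEC) :
    N.arcTgt s = .inr (.inl e) ↔
    match s with
    | .inp _ e' _ => e' = e
    | .mid _ e' _ => e' = e
    | .out _ _ _ => False := by
  cases s <;> simp [arcTgt]

theorem arcTgt_eq_output_iff (N : UnicastNetwork V E) (j : Fin 3) (s : N.LEC) :
    N.arcTgt s = .inr (.inr j) ↔
    match s with
    | .inp _ _ _ => False
    | .mid _ _ _ => False
    | .out _ j' _ => j' = j := by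
  cases s <;> simp [arcTgt]

theorem not_transGen_self (N : UnicastNetwork V E) (e : E) :
    ¬ Relation.TransGen (fun e₁ e₂ ↦ N.head e₁ = N.tail e₂) e e := fun h ↦
  N.acyclic (N.tail e) (h.lift N.tail fun e₁ _ h ↦ ⟨e₁, rfl, h⟩)

/-- A LEC is of one of three kinds. -/
def lecEquiv (N : UnicastNetwork V E) : N.LEC ≃ {p : Fin 3 × E // N.tail p.2 = N.source p.1} ⊕
    {p : E × E // N.head p.1 = N.tail p.2} ⊕ {p : E × Fin 3 // N.head p.1 = N.sink p.2} where
  toFun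
    | .inp i e h => .inl ⟨(i, e), h⟩
    | .mid e' e h => .inr (.inl ⟨(e', e), h⟩)
    | .out e j h => .inr (.inr ⟨(e, j), h⟩)
  invFun
    | .inl p => .inp p.1.1 p.1.2 p.2
    | .inr (.inl p) => .mid p.1.1 p.1.2 p.2
    | .inr (.inr p) => .out p.1.1 p.1.2 p.2
  left_inv s := by cases s <;> rfl
  right_inv p := by rcases p with p | p | p <;> rfl

instance [DecidableEq V] [Fintype E] (N : UnicastNetwork V E) : Fintype N.LEC :=
  Fintype.ofEquiv _ N.lecEquiv.symm

theorem _root_.Fintype.sum_subtype_eq_sum_dite {α R : Type*} [AddCommMonoid R] [Fintype α]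
    {p : α → Prop} [DecidablePred p] (f : {a // p a} → R) :
    ∑ a, f a = ∑ a, if h : p a then f ⟨a, h⟩ else 0 := by
  rw [← Fintype.sum_subtype_add_sum_subtype p]
  have h1 : ∑ a : {a // ¬ p a}, (if h : p a then f ⟨a, h⟩ else 0) = 0 :=
    sum_eq_zero fun a _ ↦ dif_neg a.2
  rw [h1, add_zero]
  exact sum_congr rfl fun a _ ↦ by rw [dif_pos a.2]

variable [Fintype E]

open Classical in
/-- A topological numbering of the vertices. -/
def rank (N : UnicastNetwork V E) : Fin 3 ⊕ E ⊕ Fin 3 → ℕ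
  | .inl _ => 0
  | .inr (.inl e) => #{e' | Relation.TransGen (fun e₁ e₂ ↦ N.head e₁ = N.tail e₂) e' e} + 1
  | .inr (.inr _) => Fintype.card E + 1

theorem rank_link_le (N : UnicastNetwork V E) (e : E) :
    N.rank (.inr (.inl e)) < Fintype.card E + 1 := by
  classical
  refine Nat.succ_lt_succ (card_lt_univ_of_notMem (x := e) ?_)
  simpa using N.not_transGen_self e

theorem rank_lt (N : UnicastNetwork V E) (u : Fin 3 ⊕ E ⊕ Fin 3) :
    N.rank u < Fintype.card E + 2 := by
  rcases u with i | e | j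
  · simp [rank]
  · exact (N.rank_link_le e).trans (Nat.lt_succ_self _)
  · simp [rank]

theorem rank_arcSrc_lt (N : UnicastNetwork V E) (s : N.LEC) :
    N.rank (N.arcSrc s) < N.rank (N.arcTgt s) := by
  classical
  rcases s with ⟨i, e, h⟩ | ⟨e', e, h⟩ | ⟨e, j, h⟩
  · exact Nat.succ_pos _
  · refine Nat.succ_lt_succ (card_lt_card ?_)
    rw [ssubset_iff_of_subset]
    · exact ⟨e', by simpa using .single h, by simpa using N.not_transGen_self e'⟩
    · intro x hx
      simp only [mem_filter, mem_univ, true_and] at hx ⊢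
      exact hx.tail h
  · exact N.rank_link_le e

variable [DecidableEq V]

theorem sum_LEC (N : UnicastNetwork V E) {R : Type*} [AddCommMonoid R] (F : N.LEC → R) :
    ∑ s, F s = (∑ i, ∑ e, if h : N.tail e = N.source i then F (.inp i e h) else 0) +
      ((∑ e', ∑ e, if h : N.head e' = N.tail e then F (.mid e' e h) else 0) +
        ∑ e, ∑ j, if h : N.head e = N.sink j then F (.out e j h) else 0) := by
  rw [← N.lecEquiv.symm.sum_comp F, Fintype.sum_sum_type, Fintype.sum_sum_type,
    Fintype.sum_subtype_eq_sum_dite, Fintype.sum_subtype_eq_sum_dite,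
    Fintype.sum_subtype_eq_sum_dite, Fintype.sum_prod_type, Fintype.sum_prod_type,
    Fintype.sum_prod_type]
  rfl

section
variable [DecidableEq E] (N : UnicastNetwork V E) {R : Type*} [CommRing R]

theorem arcMatrix_pow_source (ε : N.LEC → R) (i i' : Fin 3) (t : ℕ) :
    (arcMatrix N.arcSrc N.arcTgt ε ^ t) (.inl i) (.inl i') = if i' = i ∧ t = 0 then 1 else 0 := by
  cases t with
  | zero => by_cases h : i = i' <;> simp [h, eq_comm]
  | succ t =>
    rw [pow_succ, mul_arcMatrix_apply, if_neg (by simp)]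
    refine sum_eq_zero fun s _ ↦ if_neg ?_
    cases s <;> simp [arcTgt]

/-- The recursion for link symbols splits off the last arc of a path, as right multiplication by the
adjacency matrix does. -/
theorem linkSymbol_impulse (ε : N.LEC → R) (i : Fin 3) (t : ℕ) (e : E) :
    N.linkSymbol ε (fun i' t ↦ if i' = i ∧ t = 0 then 1 else 0) t e =
      (arcMatrix N.arcSrc N.arcTgt ε ^ t) (.inl i) (.inr (.inl e)) := by
  induction t generalizing e with
  | zero => simp [linkSymbol]
  | succ t ih =>
    rw [pow_succ, mul_arcMatrix_apply, sum_LEC, linkSymbol]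
    simp only [arcTgt_eq_link_iff, arcSrc, arcMatrix_pow_source, ← ih]
    simp only [if_false, dite_eq_ite, ite_self, sum_const_zero, add_zero]
    congr 1
    · refine sum_congr rfl fun i' _ ↦ ?_
      rw [sum_eq_single e]
      · simp
      · intro e₁ _ h; simp [h]
      · simp
    · refine sum_congr rfl fun e' _ ↦ ?_
      rw [sum_eq_single e]
      · simp
      · intro e₁ _ h; simp [h]
      · simp

theorem transferCoeff_eq (ε : N.LEC → R) (i j : Fin 3) (d : ℕ) :
    N.transferCoeff ε i j d =
      (arcMatrix N.arcSrc N.arcTgt ε ^ d) (.inl i) (.inr (.inr j)) := by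
  cases d with
  | zero => simp [transferCoeff, output]
  | succ t =>
    rw [transferCoeff, output, pow_succ, mul_arcMatrix_apply, sum_LEC]
    simp only [arcTgt_eq_output_iff, arcSrc, ← linkSymbol_impulse]
    simp only [if_false, dite_eq_ite, ite_self, sum_const_zero, zero_add]
    refine sum_congr rfl fun e _ ↦ ?_
    rw [sum_eq_single j]
    · simp
    · intro j' _ h; simp [h]
    · simp

theorem transfer_eq_pathSum (ε : N.LEC → R) (D : R) (i j : Fin 3) :
    N.transfer ε D i j =
      pathSum N.arcSrc N.arcTgt (Fintype.card E + 2) (D • ε) (.inl i) (.inr (.inr j)) := by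
  rw [transfer, pathSum, Matrix.sum_apply]
  refine sum_congr rfl fun d _ ↦ ?_
  rw [transferCoeff_eq, arcMatrix_smul, smul_pow, Matrix.smul_apply, smul_eq_mul, mul_comm]

end

variable (N : UnicastNetwork V E)

/-- A path has as many LECs as its delay. -/
theorem transfer_eq_transfer_smul {R : Type*} [CommRing R] (ε : N.LEC → R) (D : R) :
    N.transfer ε D = N.transfer (D • ε) 1 := by
  classical
  ext i j
  rw [transfer_eq_pathSum, transfer_eq_pathSum, one_smul]

theorem map_transfer {R S : Type*} [CommRing R] [CommRing S] (φ : R →+* S) (ε : N.LEC → R)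
    (D : R) (i j : Fin 3) : φ (N.transfer ε D i j) = N.transfer (φ ∘ ε) (φ D) i j := by
  classical
  rw [transfer_eq_pathSum, transfer_eq_pathSum, map_pathSum]
  congr 1
  ext s
  simp

theorem crossRatio {K : Type*} [Field K] {i₁ i₂ j₁ j₂ : Fin 3} [DecidableEq N.LEC]
    (M : Fin 3 → Fin 3 → MvPolynomial N.LEC K) (hM : M = N.transfer MvPolynomial.X 1)
    (h₁₁ : M i₁ j₁ ≠ 0) (h₁₂ : M i₁ j₂ ≠ 0) (h₂₁ : M i₂ j₁ ≠ 0) (h₂₂ : M i₂ j₂ ≠ 0) :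
    M i₁ j₁ * M i₂ j₂ = M i₁ j₂ * M i₂ j₁ ∨
      FractionalLinear (M i₁ j₁ * M i₂ j₂) (M i₁ j₂ * M i₂ j₁) := by
  classical
  have hM' : ∀ i j, M i j = pathSum N.arcSrc N.arcTgt (Fintype.card E + 2) MvPolynomial.X (.inl i)
      (.inr (.inr j)) := fun i j ↦ by rw [hM, transfer_eq_pathSum, one_smul]
  simp only [hM'] at *
  exact crossRatio_fractionalLinear N.rank_arcSrc_lt N.rank_lt _ rfl _ _ h₁₁ h₁₂ h₂₁ h₂₂

end UnicastNetwork

/-! ### The obstruction to arbitrary precoding -/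

namespace UnicastNetwork

open Module

/-- `η` as a function of the transfer functions. -/
def etaOf {L : Type*} [Field L] (M : Fin 3 → Fin 3 → L) : L :=
  (M 1 0 * M 2 1 * M 0 2) / (M 2 0 * M 1 2 * M 0 1)

/-- `b₁, b₂, b₃` as functions of the transfer functions. -/
def bOf {L : Type*} [Field L] (M : Fin 3 → Fin 3 → L) : Fin 3 → L :=
  ![(M 1 0 * M 0 2) / (M 0 0 * M 1 2),
    (M 1 1 * M 0 2) / (M 0 1 * M 1 2),
    (M 2 2 * M 0 1) / (M 0 2 * M 2 1)]

section

variable {L : Type*} [Field L] {n : ℕ} {len : Fin 3 → ℕ}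
  {H : Fin 3 → Fin 3 → Matrix (Fin n) (Fin n) L} {W : ∀ i, Matrix (Fin n) (Fin (len i)) L}

/-- The decoder need not be linear, but two inputs with equal outputs differ by an input with output
zero. -/
theorem recoverable_iff {j : Fin 3} : Recoverable H W j ↔
    ∀ x : (∀ i, Fin (len i) → L), ∑ i, H i j *ᵥ (W i *ᵥ x i) = 0 → x j = 0 := by
  constructor
  · rintro ⟨dec, hdec⟩ x hx
    have h0 := hdec 0
    simp only [Pi.zero_apply, Matrix.mulVec_zero, Finset.sum_const_zero] at h0
    rw [← hdec x, hx, h0]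
  · intro h
    classical
    refine ⟨fun y ↦ if hy : ∃ x : (∀ i, Fin (len i) → L), ∑ i, H i j *ᵥ (W i *ᵥ x i) = y
      then hy.choose j else 0, fun x ↦ ?_⟩
    have hy : ∃ x' : (∀ i, Fin (len i) → L),
      ∑ i, H i j *ᵥ (W i *ᵥ x' i) = ∑ i, H i j *ᵥ (W i *ᵥ x i) := ⟨x, rfl⟩
    dsimp only
    rw [dif_pos hy, ← sub_eq_zero]
    refine h (hy.choose - x) ?_
    have := hy.choose_spec
    simp only [Pi.sub_apply, Matrix.mulVec_sub, Finset.sum_sub_distrib]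
    rw [this, sub_self]

/-- An `L`-linear functional on `L'`, applied coordinatewise, sends an undecodable input over `L'`
to one over `L`; functionals separate points. -/
theorem Recoverable.map {L' : Type*} [Field L'] (φ : L →+* L') {j : Fin 3}
    (h : Recoverable H W j) :
    Recoverable (fun i j ↦ (H i j).map φ) (fun i ↦ (W i).map φ) j := by
  rw [recoverable_iff] at h ⊢
  intro x hx
  let := φ.toAlgebra
  have hφ : ∀ (lam : L' →ₗ[L] L) (a : L) (z : L'), lam (φ a * z) = a * lam z := fun lam a z ↦ by
    rw [← smul_eq_mul a, ← lam.map_smul, Algebra.smul_def]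
    rfl
  ext c
  rw [Pi.zero_apply, ← Module.forall_dual_apply_eq_zero_iff L]
  intro lam
  refine congrFun (h (fun i c ↦ lam (x i c)) ?_) c
  ext q
  have := congrArg lam (congrFun hx q)
  simpa [-Matrix.mulVec_mulVec, Finset.sum_apply, Matrix.mulVec, dotProduct, map_sum, hφ] using this

theorem finrank_map_of_injective {U : Type*} [AddCommGroup U] [Module L U] {f : U →ₗ[L] U}
    (hf : Function.Injective f) (P : Submodule L U) : finrank L (P.map f) = finrank L P :=
  (P.equivMapOfInjective f hf).finrank_eq.symm

/-- The source of alignment: once the desired signal `P` and the interferer `Q` fill the space,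
there is no room for the other interferer `S` outside `Q`. -/
theorem le_of_disjoint_sup_of_finrank {U : Type*} [AddCommGroup U] [Module L U]
    [FiniteDimensional L U] {P Q S : Submodule L U} (h : Disjoint P (Q ⊔ S))
    (hdim : finrank L U ≤ finrank L P + finrank L Q) : S ≤ Q := by
  have h1 := Submodule.finrank_sup_add_finrank_inf_eq P (Q ⊔ S)
  rw [h.eq_bot, finrank_bot, add_zero] at h1
  have h2 := Submodule.finrank_le (P ⊔ (Q ⊔ S))
  have : Q = Q ⊔ S := Submodule.eq_of_le_of_finrank_le le_sup_left (by omega)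
  exact this ▸ le_sup_right

end

/-- `cB` and `ctB` have dimension `n'` inside a space of dimension `n' + 1`, so they meet in
dimension at least `n' - 1`, which is positive because `n' > 1`. -/
theorem exists_ne_zero_mem_of_mul_mem {L : Type*} [Field L] {n n' : ℕ}
    {A B : Submodule L (Fin n → L)} {t c : Fin n → L} (ht : ∀ q, t q ≠ 0) (hc : ∀ q, c q ≠ 0)
    (hn' : 1 < n') (hA : finrank L A = n' + 1) (hB : finrank L B = n')
    (hcB : ∀ y ∈ B, c * y ∈ A) (htB : ∀ y ∈ B, c * (t * y) ∈ A) :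
    ∃ y ∈ B, y ≠ 0 ∧ t * y ∈ B := by
  have hinj : ∀ s : Fin n → L, (∀ q, s q ≠ 0) → Function.Injective (LinearMap.mulLeft L s) := by
    intro s hs y z h
    ext q
    exact mul_left_cancel₀ (hs q) (congrFun h q)
  have hrank : ∀ s : Fin n → L, (∀ q, s q ≠ 0) →
      finrank L (B.map (LinearMap.mulLeft L s)) = n' := fun s hs ↦ by
    rw [finrank_map_of_injective (hinj s hs), hB]
  have h1 := hrank c hc
  have h2 := hrank (c * t) fun q ↦ mul_ne_zero (hc q) (ht q)
  have h3 := Submodule.finrank_sup_add_finrank_inf_eq (B.map (LinearMap.mulLeft L c))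
    (B.map (LinearMap.mulLeft L (c * t)))
  have h4 : B.map (LinearMap.mulLeft L c) ⊔ B.map (LinearMap.mulLeft L (c * t)) ≤ A := by
    refine sup_le ?_ ?_ <;> rintro _ ⟨y, hy, rfl⟩
    · exact hcB y hy
    · simpa [mul_assoc] using htB y hy
  have h5 := Submodule.finrank_mono h4
  have h6 : B.map (LinearMap.mulLeft L c) ⊓ B.map (LinearMap.mulLeft L (c * t)) ≠ ⊥ := by
    intro h
    rw [h, finrank_bot] at h3
    omega
  obtain ⟨z, ⟨⟨y', hy', hz'⟩, ⟨y, hy, hz⟩⟩, hz0⟩ := Submodule.exists_mem_ne_zero_of_ne_bot h6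
  refine ⟨y, hy, ?_, ?_⟩
  · rintro rfl
    exact hz0 (by rw [← hz, map_zero])
  · have : t * y = y' := hinj c hc (by
      rw [hz', ← hz]
      simp)
    rwa [this]

/-- If some `b_i` is the same fractional linear function of `η` at all coordinates, then precoding
over diagonal channels fails. -/
theorem not_recoverable {L : Type*} [Field L] {n' : ℕ} (hn' : 1 < n')
    {M : Fin (2 * n' + 1) → Fin 3 → Fin 3 → L} (hM : ∀ q i j, M q i j ≠ 0) {i : Fin 3}
    {g₀ g₁ d₀ d₁ : L} (hgd : ∀ t, g₀ + g₁ * t = 0 → d₀ + d₁ * t ≠ 0)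
    (hb : ∀ q, bOf (M q) i * (d₀ + d₁ * etaOf (M q)) = g₀ + g₁ * etaOf (M q))
    (W : ∀ i, Matrix (Fin (2 * n' + 1)) (Fin (lens n' i)) L) :
    ¬ ∀ j, Recoverable (fun i j ↦ Matrix.diagonal fun q ↦ M q i j) W j := by
  intro hW
  simp only [recoverable_iff] at hW
  set h : Fin 3 → Fin 3 → Fin (2 * n' + 1) → L := fun i j q ↦ M q i j with hh
  have hdiag : ∀ i j y, (Matrix.diagonal fun q ↦ M q i j) *ᵥ y = h i j * y := by
    intro i j y
    ext q
    simp [hh, Matrix.mulVec_diagonal]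
  simp only [hdiag] at hW
  -- Taking all other inputs to be zero shows that each precoding matrix is injective.
  have hinj : ∀ j, Function.Injective (W j).mulVecLin := by
    intro j
    rw [← LinearMap.ker_eq_bot, LinearMap.ker_eq_bot']
    intro x hx
    have := hW j (Pi.single j x) (by
      refine Finset.sum_eq_zero fun i _ ↦ ?_
      by_cases hij : i = j
      · subst hij
        rw [Pi.single_eq_same]
        simp only [Matrix.mulVecLin_apply] at hx
        rw [hx, mul_zero]
      · rw [Pi.single_eq_of_ne hij, Matrix.mulVec_zero, mul_zero])
    simpa using this
  set Y : Fin 3 → Submodule L (Fin (2 * n' + 1) → L) := fun j ↦ LinearMap.range (W j).mulVecLin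
  have hY : ∀ j, finrank L (Y j) = lens n' j := fun j ↦ by
    rw [LinearMap.finrank_range_of_inj (hinj j), finrank_fin_fun]
  have hY0 : finrank L (Y 0) = n' + 1 := hY 0
  have hY1 : finrank L (Y 1) = n' := hY 1
  have hY2 : finrank L (Y 2) = n' := hY 2
  have hrec : ∀ j (y : Fin 3 → Fin (2 * n' + 1) → L), (∀ i, y i ∈ Y i) →
      h 0 j * y 0 + h 1 j * y 1 + h 2 j * y 2 = 0 → y j = 0 := by
    intro j y hy hsum
    choose x hx using hy
    have := hW j x (by
      rw [Fin.sum_univ_three]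
      simp only [Matrix.mulVecLin_apply] at hx
      rw [hx, hx, hx, hsum])
    rw [← hx j, this, map_zero]
  have hmulinj : ∀ i j, Function.Injective (LinearMap.mulLeft L (h i j)) := by
    intro i j y z hyz
    ext q
    exact mul_left_cancel₀ (hM q i j) (congrFun hyz q)
  have hmap : ∀ i j, finrank L ((Y i).map (LinearMap.mulLeft L (h i j))) = finrank L (Y i) :=
    fun i j ↦ finrank_map_of_injective (hmulinj i j) _
  have hamb : finrank L (Fin (2 * n' + 1) → L) = 2 * n' + 1 := finrank_fin_fun L
  -- Alignment at the three destinations: each time the desired space and one interfering space have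
  -- dimensions `n' + 1` and `n'`, in some order.
  have c0 : ∀ y ∈ Y 1, ∃ z ∈ Y 2, h 2 0 * z = h 1 0 * y := by
    have := le_of_disjoint_sup_of_finrank (P := (Y 0).map (LinearMap.mulLeft L (h 0 0)))
      (Q := (Y 2).map (LinearMap.mulLeft L (h 2 0))) (S := (Y 1).map (LinearMap.mulLeft L (h 1 0)))
      (by
        rw [Submodule.disjoint_def]
        rintro _ ⟨y, hy, rfl⟩ hm
        obtain ⟨_, ⟨y2, hy2, rfl⟩, _, ⟨y1, hy1, rfl⟩, he⟩ := Submodule.mem_sup.mp hm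
        have := hrec 0 ![y, -y1, -y2] (by
          intro i; fin_cases i
          · exact hy
          · exact neg_mem hy1
          · exact neg_mem hy2) (by
          simp only [LinearMap.mulLeft_apply] at he
          simp [← he])
        simp at this
        rw [this, map_zero]) (by rw [hamb, hmap, hmap, hY0, hY2]; omega)
    intro y hy
    exact this ⟨y, hy, rfl⟩
  have c1 : ∀ y ∈ Y 2, ∃ z ∈ Y 0, h 0 1 * z = h 2 1 * y := by
    have := le_of_disjoint_sup_of_finrank (P := (Y 1).map (LinearMap.mulLeft L (h 1 1)))
      (Q := (Y 0).map (LinearMap.mulLeft L (h 0 1))) (S := (Y 2).map (LinearMap.mulLeft L (h 2 1)))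
      (by
        rw [Submodule.disjoint_def]
        rintro _ ⟨y, hy, rfl⟩ hm
        obtain ⟨_, ⟨y2, hy2, rfl⟩, _, ⟨y1, hy1, rfl⟩, he⟩ := Submodule.mem_sup.mp hm
        have := hrec 1 ![-y2, y, -y1] (by
          intro i; fin_cases i
          · exact neg_mem hy2
          · exact hy
          · exact neg_mem hy1) (by
          simp only [LinearMap.mulLeft_apply] at he
          simp [← he])
        simp at this
        rw [this, map_zero]) (by rw [hamb, hmap, hmap, hY0, hY1]; omega)
    intro y hy
    exact this ⟨y, hy, rfl⟩
  have c2 : ∀ y ∈ Y 1, ∃ z ∈ Y 0, h 0 2 * z = h 1 2 * y := by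
    have := le_of_disjoint_sup_of_finrank (P := (Y 2).map (LinearMap.mulLeft L (h 2 2)))
      (Q := (Y 0).map (LinearMap.mulLeft L (h 0 2))) (S := (Y 1).map (LinearMap.mulLeft L (h 1 2)))
      (by
        rw [Submodule.disjoint_def]
        rintro _ ⟨y, hy, rfl⟩ hm
        obtain ⟨_, ⟨y2, hy2, rfl⟩, _, ⟨y1, hy1, rfl⟩, he⟩ := Submodule.mem_sup.mp hm
        have := hrec 2 ![-y2, -y1, y] (by
          intro i; fin_cases i
          · exact neg_mem hy2
          · exact neg_mem hy1
          · exact hy) (by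
          simp only [LinearMap.mulLeft_apply] at he
          simp [← he]
          ring)
        simp at this
        rw [this, map_zero]) (by rw [hamb, hmap, hmap, hY0, hY2]; omega)
    intro y hy
    exact this ⟨y, hy, rfl⟩
  -- Going from the second space to the first directly multiplies by `c`; going through the third
  -- multiplies by `cη`.
  set t : Fin (2 * n' + 1) → L := fun q ↦ etaOf (M q) with ht
  set c : Fin (2 * n' + 1) → L := fun q ↦ M q 1 2 / M q 0 2 with hc
  have e2 : ∀ y ∈ Y 1, c * y ∈ Y 0 := by
    intro y hy
    obtain ⟨z, hz, he⟩ := c2 y hy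
    convert hz using 1
    ext q
    have h1 := congrFun he q
    simp only [Pi.mul_apply, hh, hc] at h1 ⊢
    have := hM q 0 2
    field_simp
    linear_combination -h1
  have e1 : ∀ y ∈ Y 1, c * (t * y) ∈ Y 0 := by
    intro y hy
    obtain ⟨y2, hy2, he0⟩ := c0 y hy
    obtain ⟨z, hz, he1⟩ := c1 y2 hy2
    convert hz using 1
    ext q
    have h0 := congrFun he0 q
    have h1 := congrFun he1 q
    simp only [Pi.mul_apply, hh, hc, ht, etaOf] at h0 h1 ⊢
    have := hM q 0 2
    have := hM q 1 2
    have := hM q 2 0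
    have := hM q 0 1
    field_simp
    linear_combination -M q 2 1 * h0 - M q 2 0 * h1
  obtain ⟨y, hy, hy0, hty⟩ := exists_ne_zero_mem_of_mul_mem (t := t) (c := c)
    (fun q ↦ by simp [ht, etaOf, hM]) (fun q ↦ by simp [hc, hM]) hn' hY0 hY1 e2 e1
  -- With `b_i = g/d`, the vectors `v = d(η) y` and `z = c g(η) y` satisfy `z = b_i c v`.
  set v : Fin (2 * n' + 1) → L := d₀ • y + d₁ • (t * y) with hv
  have hvY : v ∈ Y 1 := add_mem (Submodule.smul_mem _ _ hy) (Submodule.smul_mem _ _ hty)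
  set z : Fin (2 * n' + 1) → L := g₀ • (c * y) + g₁ • (c * (t * y)) with hz
  have hzY : z ∈ Y 0 := add_mem (Submodule.smul_mem _ _ (e2 y hy)) (Submodule.smul_mem _ _ (e1 y hy))
  have htzY : t * z ∈ Y 0 := by
    have : t * z = g₀ • (c * (t * y)) + g₁ • (c * (t * (t * y))) := by
      ext q
      simp [hz]
      ring
    rw [this]
    exact add_mem (Submodule.smul_mem _ _ (e1 y hy)) (Submodule.smul_mem _ _ (e1 _ hty))
  have hvz : ∀ q, z q = bOf (M q) i * (M q 1 2 / M q 0 2) * v q := by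
    intro q
    simp only [hz, hv, hc, ht, Pi.add_apply, Pi.smul_apply, Pi.mul_apply, smul_eq_mul]
    linear_combination -(M q 1 2 / M q 0 2 * y q) * hb q
  have hbne : ∀ q, bOf (M q) i ≠ 0 := by
    intro q
    fin_cases i <;> simp [bOf, hM]
  -- Where `y` is nonzero, `v = 0` would make `d(η)` vanish, and then `g(η)` too by `hb`, contrary
  -- to `hgd`.
  have hv0 : v ≠ 0 := by
    intro hv0
    apply hy0
    ext q
    by_contra hyq
    have h1 : (d₀ + d₁ * t q) * y q = 0 := by
      have := congrFun hv0 q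
      simp only [hv, Pi.add_apply, Pi.smul_apply, Pi.mul_apply, smul_eq_mul, Pi.zero_apply] at this
      linear_combination this
    have h2 := (mul_eq_zero.mp h1).resolve_right hyq
    have h3 := hb q
    rw [h2, mul_zero] at h3
    exact hgd _ h3.symm h2
  have hz0 : z ≠ 0 := by
    intro hz0
    apply hv0
    ext q
    have h1 := hvz q
    rw [hz0, Pi.zero_apply, eq_comm] at h1
    exact (mul_eq_zero.mp h1).resolve_left
      (mul_ne_zero (hbne q) (div_ne_zero (hM _ _ _) (hM _ _ _)))
  -- At destinations 1 and 2, `z` from source 1 and `-v` from source 2 cancel.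
  fin_cases i
  · refine hz0 (hrec 0 ![z, -v, 0] ?_ ?_)
    · intro i; fin_cases i
      · exact hzY
      · exact neg_mem hvY
      · exact zero_mem _
    · ext q
      have := hM q 0 2
      have := hM q 0 0
      have := hM q 1 2
      simp [hh, hvz, bOf]
      field_simp
      ring
  · refine hv0 (neg_eq_zero.mp (hrec 1 ![z, -v, 0] ?_ ?_))
    · intro i; fin_cases i
      · exact hzY
      · exact neg_mem hvY
      · exact zero_mem _
    · ext q
      have := hM q 0 2
      have := hM q 0 1
      have := hM q 1 2
      simp [hh, hvz, bOf]
      field_simp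
      ring
  -- At destination 3 the cancelling pair is `ηz` from source 1 and `-y2` from source 3, where `y2`
  -- is the vector aligned with `v` at destination 1.
  · obtain ⟨y2, hy2, he⟩ := c0 v hvY
    have hy20 : -y2 = 0 := hrec 2 ![t * z, 0, -y2] (by
      intro i; fin_cases i
      · exact htzY
      · exact zero_mem _
      · exact neg_mem hy2) (by
      ext q
      have h1 := congrFun he q
      have := hM q 0 2
      have := hM q 0 1
      have := hM q 1 2
      have := hM q 2 1
      have := hM q 2 0
      simp only [Pi.mul_apply, hh] at h1
      simp [hh, hvz, bOf, ht, etaOf]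
      field_simp
      linear_combination -M q 2 2 * h1)
    apply hv0
    ext q
    have h1 := congrFun he q
    rw [neg_eq_zero.mp hy20] at h1
    simpa [hh, hM] using h1.symm

end UnicastNetwork

/-! ### Decodability from independent columns -/

namespace UnicastNetwork

open Module

section

variable {L : Type*} [Field L]

/-- The factor of the second block of columns of the matrix whose rank decides whether destination
`i` can decode. -/
def colFactor (M : Fin 3 → Fin 3 → L) : Fin 3 → L :=
  ![bOf M 0, bOf M 1, bOf M 2 * etaOf M]

/-- The columns `1, η, …, η^{n'}, c, c η, …, c η^{n'-1}` with `c = colFactor M i` are linearly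
independent. -/
def ColumnsIndependent {n : ℕ} (n' : ℕ) (M : Fin n → Fin 3 → Fin 3 → L) (i : Fin 3) : Prop :=
  ∀ (f : Fin (n' + 1) → L) (g : Fin n' → L),
    (∀ q, (∑ c, f c * etaOf (M q) ^ (c : ℕ)) +
      colFactor (M q) i * ∑ c, g c * etaOf (M q) ^ (c : ℕ) = 0) → f = 0 ∧ g = 0

/-- The explicit precoders align the interference: each received vector becomes a common factor
times `f(η) + colFactor * g(η)`, and the desired symbols are coefficients not mixed with
interference. -/
theorem exists_recoverable {n n' : ℕ} {M : Fin n → Fin 3 → Fin 3 → L}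
    (hM : ∀ q i j, M q i j ≠ 0) (h : ∀ i, ColumnsIndependent n' M i) :
    ∃ W : ∀ i, Matrix (Fin n) (Fin (lens n' i)) L,
      ∀ j, Recoverable (fun i j ↦ Matrix.diagonal fun q ↦ M q i j) W j := by
  refine ⟨fun i ↦ Matrix.of fun q c ↦ ![1, M q 0 2 / M q 1 2, M q 0 1 / M q 2 1 * etaOf (M q)] i *
    etaOf (M q) ^ (c : ℕ), fun j ↦ ?_⟩
  rw [recoverable_iff]
  intro x hx
  let x₀ : Fin (n' + 1) → L := x 0
  let x₁ : Fin n' → L := x 1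
  let x₂ : Fin n' → L := x 2
  set F : Fin n → L := fun q ↦ ∑ c : Fin (n' + 1), x₀ c * etaOf (M q) ^ (c : ℕ) with hF
  set G₁ : Fin n → L := fun q ↦ ∑ c : Fin n', x₁ c * etaOf (M q) ^ (c : ℕ) with hG₁
  set G₂ : Fin n → L := fun q ↦ ∑ c : Fin n', x₂ c * etaOf (M q) ^ (c : ℕ) with hG₂
  have hsum : ∀ q, M q 0 j * F q + M q 1 j * (M q 0 2 / M q 1 2 * G₁ q) +
      M q 2 j * (M q 0 1 / M q 2 1 * etaOf (M q) * G₂ q) = 0 := by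
    intro q
    have := congrFun hx q
    simp only [Fin.sum_univ_three, Pi.add_apply, Matrix.mulVec_diagonal, Pi.zero_apply] at this
    rw [← this]
    congr 2
    · congr 1
      refine Finset.sum_congr rfl fun c _ ↦ ?_
      change x₀ c * etaOf (M q) ^ (c : ℕ) = 1 * etaOf (M q) ^ (c : ℕ) * x₀ c
      ring
    · congr 1
      simp only [hG₁, Finset.mul_sum]
      refine Finset.sum_congr rfl fun c _ ↦ ?_
      change _ = M q 0 2 / M q 1 2 * etaOf (M q) ^ (c : ℕ) * x₁ c
      ring
    · simp only [hG₂, Finset.mul_sum]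
      refine Finset.sum_congr rfl fun c _ ↦ ?_
      change _ = M q 0 1 / M q 2 1 * etaOf (M q) * etaOf (M q) ^ (c : ℕ) * x₂ c
      ring
  fin_cases j
  · refine (h 0 x₀ (fun c : Fin n' ↦ x₁ c + x₂ c) fun q ↦ ?_).1
    have h1 : ∑ c : Fin n', (x₁ c + x₂ c) * etaOf (M q) ^ (c : ℕ) = G₁ q + G₂ q := by
      simp only [hG₁, hG₂, ← Finset.sum_add_distrib, add_mul]
    rw [h1]
    have h2 := hsum q
    change F q + _ = 0
    have := hM q
    simp [colFactor, bOf, etaOf] at h2 ⊢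
    field_simp [this] at h2 ⊢
    linear_combination h2
  -- The extra `η` in the third precoder shifts its exponents to `1, …, n'`, hence the leading zero.
  · refine (h 1 (fun c ↦ x₀ c + (Fin.cons 0 x₂ : Fin (n' + 1) → L) c) x₁ fun q ↦ ?_).2
    have h1 : ∑ c : Fin (n' + 1), (x₀ c + (Fin.cons 0 x₂ : Fin (n' + 1) → L) c) *
        etaOf (M q) ^ (c : ℕ) = F q + etaOf (M q) * G₂ q := by
      simp only [add_mul, Finset.sum_add_distrib]
      congr 1
      rw [Fin.sum_univ_succ, Fin.cons_zero, zero_mul, zero_add, Finset.mul_sum]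
      refine Finset.sum_congr rfl fun c _ ↦ ?_
      rw [Fin.cons_succ, Fin.val_succ, pow_succ]
      ring
    rw [h1]
    have h2 := hsum q
    change F q + _ + _ * G₁ q = 0
    have := hM q
    simp [colFactor, bOf] at h2 ⊢
    field_simp [this] at h2 ⊢
    linear_combination h2
  -- Here the interferer from source 2 has exponents only up to `n' - 1`, hence the trailing zero.
  · refine (h 2 (fun c ↦ x₀ c + (Fin.snoc x₁ 0 : Fin (n' + 1) → L) c) x₂ fun q ↦ ?_).2
    have h1 : ∑ c : Fin (n' + 1), (x₀ c + (Fin.snoc x₁ 0 : Fin (n' + 1) → L) c) *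
        etaOf (M q) ^ (c : ℕ) = F q + G₁ q := by
      simp only [add_mul, Finset.sum_add_distrib]
      congr 1
      rw [Fin.sum_univ_castSucc, Fin.snoc_last, zero_mul, add_zero]
      refine Finset.sum_congr rfl fun c _ ↦ ?_
      rw [Fin.snoc_castSucc, Fin.val_castSucc]
    rw [h1]
    have h2 := hsum q
    change F q + _ + _ * G₂ q = 0
    have := hM q
    simp [colFactor, bOf] at h2 ⊢
    field_simp [this] at h2 ⊢
    linear_combination h2

theorem mulVec_eq_zero_of_rank {m n : Type*} [Fintype n] {A : Matrix m n L}
    (h : A.rank = Fintype.card n) {x : n → L} (hx : A *ᵥ x = 0) : x = 0 := by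
  have h1 := A.mulVecLin.finrank_range_add_finrank_ker
  rw [finrank_fintype_fun_eq_card, ← h, Matrix.rank] at h1
  have h2 : LinearMap.ker A.mulVecLin = ⊥ := Submodule.finrank_eq_zero.mp (by omega)
  exact LinearMap.ker_eq_bot'.mp h2 x hx

end

variable {V E : Type*} [DecidableEq V] [Fintype E] (N : UnicastNetwork V E)
  {L : Type*} [Field L] {ε : N.LEC → L} {a : L} {n' : ℕ}

/-- A zero direct channel would kill a block of `n'` columns; for `i = 0` this uses that the matrix
inverse of `0` is `0`. -/
theorem RankConditions.hatM_ne_zero (h : N.RankConditions ε a n') (hn' : n' ≠ 0) (i : Fin 3) :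
    N.hatM ε a (2 * n' + 1) i i ≠ 0 := by
  have hg : (fun _ : Fin n' ↦ (1 : L)) ≠ 0 := fun h ↦ by
    have := congrFun h ⟨0, Nat.pos_of_ne_zero hn'⟩
    exact one_ne_zero this
  intro h0
  obtain ⟨h1, h2, h3⟩ := h
  fin_cases i
  · have := mulVec_eq_zero_of_rank (h1.trans (by simp; omega)) (x := Sum.elim 0 fun _ ↦ 1) (by
      rw [Matrix.fromCols_mulVec_sumElim]
      change N.hatM ε a (2 * n' + 1) 0 0 = 0 at h0
      simp [h0])
    exact hg (funext fun c ↦ congrFun this (.inr c))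
  · have := mulVec_eq_zero_of_rank (h2.trans (by simp; omega)) (x := Sum.elim (fun _ ↦ 1) 0) (by
      rw [Matrix.fromCols_mulVec_sumElim]
      change N.hatM ε a (2 * n' + 1) 1 1 = 0 at h0
      simp [h0])
    exact hg (funext fun c ↦ congrFun this (.inl c))
  · have := mulVec_eq_zero_of_rank (h3.trans (by simp; omega)) (x := Sum.elim (fun _ ↦ 1) 0) (by
      rw [Matrix.fromCols_mulVec_sumElim]
      change N.hatM ε a (2 * n' + 1) 2 2 = 0 at h0
      simp [h0])
    exact hg (funext fun c ↦ congrFun this (.inl c))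

theorem RankConditions.columnsIndependent (h : N.RankConditions ε a n')
    (hM : ∀ (q : Fin (2 * n' + 1)) i j, N.transfer ε (a ^ (q : ℕ)) i j ≠ 0) (i : Fin 3) :
    ColumnsIndependent n' (fun q : Fin (2 * n' + 1) ↦ N.transfer ε (a ^ (q : ℕ))) i := by
  set M : Fin (2 * n' + 1) → Fin 3 → Fin 3 → L := fun q ↦ N.transfer ε (a ^ (q : ℕ)) with hMdef
  have hM' : ∀ i j, N.hatM ε a (2 * n' + 1) i j = Matrix.diagonal fun q ↦ M q i j := fun i j ↦ rfl
  have hinv : ∀ i j, (N.hatM ε a (2 * n' + 1) i j)⁻¹ = Matrix.diagonal fun q ↦ (M q i j)⁻¹ := by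
    intro i j
    refine Matrix.inv_eq_right_inv ?_
    rw [hM', Matrix.diagonal_mul_diagonal, ← Matrix.diagonal_one]
    congr 1
    ext q
    exact mul_inv_cancel₀ (hM q i j)
  have hU : N.hatU ε a (2 * n' + 1) = Matrix.diagonal fun q ↦ etaOf (M q) := by
    simp only [hatU, hinv]
    simp only [hM', Matrix.diagonal_mul_diagonal]
    congr 1
    ext q
    rw [etaOf, div_eq_mul_inv, mul_inv, mul_inv]
    ring
  have hV₁ : ∀ q c, N.V₁ ε a n' q c = etaOf (M q) ^ (c : ℕ) := by
    intro q c
    simp [V₁, hU, Matrix.diagonal_pow, Matrix.mulVec_diagonal]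
  have hV₂ : ∀ q c, N.V₂ ε a n' q c = M q 0 2 / M q 1 2 * etaOf (M q) ^ (c : ℕ) := by
    intro q c
    simp only [V₂, hatR, hinv]
    simp only [hM', hU, Matrix.diagonal_pow, Matrix.diagonal_mul_diagonal,
      Matrix.of_apply, Matrix.mulVec_diagonal]
    simp [div_eq_mul_inv]
  have hV₃ : ∀ q c, N.V₃ ε a n' q c =
      M q 0 1 / M q 2 1 * etaOf (M q) * etaOf (M q) ^ (c : ℕ) := by
    intro q c
    simp only [V₃, hatS, hinv]
    simp only [hM', hU, Matrix.diagonal_pow, Matrix.diagonal_mul_diagonal,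
      Matrix.of_apply, Matrix.mulVec_diagonal]
    simp [div_eq_mul_inv, pow_succ]
    ring
  have hV₁sum : ∀ f q, (N.V₁ ε a n' *ᵥ f) q = ∑ c, f c * etaOf (M q) ^ (c : ℕ) := by
    intro f q
    simp only [Matrix.mulVec, dotProduct, hV₁, mul_comm]
  have hV₂sum : ∀ g q, (N.V₂ ε a n' *ᵥ g) q =
      M q 0 2 / M q 1 2 * ∑ c, g c * etaOf (M q) ^ (c : ℕ) := by
    intro g q
    simp only [Matrix.mulVec, dotProduct, hV₂, Finset.mul_sum]
    exact Finset.sum_congr rfl fun c _ ↦ by ring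
  have hV₃sum : ∀ g q, (N.V₃ ε a n' *ᵥ g) q =
      M q 0 1 / M q 2 1 * etaOf (M q) * ∑ c, g c * etaOf (M q) ^ (c : ℕ) := by
    intro g q
    simp only [Matrix.mulVec, dotProduct, hV₃, Finset.mul_sum]
    exact Finset.sum_congr rfl fun c _ ↦ by ring
  obtain ⟨h1, h2, h3⟩ := h
  intro f g hfg
  fin_cases i
  · have := mulVec_eq_zero_of_rank (h1.trans (by simp; omega)) (x := Sum.elim f g) (by
      ext q
      rw [Matrix.fromCols_mulVec_sumElim, hinv, hM', Matrix.diagonal_mul_diagonal,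
        ← Matrix.mulVec_mulVec, Pi.add_apply, Matrix.mulVec_diagonal, hV₁sum, hV₂sum, Pi.zero_apply,
        ← hfg q]
      simp [colFactor, bOf]
      ring)
    exact ⟨funext fun c ↦ congrFun this (.inl c), funext fun c ↦ congrFun this (.inr c)⟩
  · have := mulVec_eq_zero_of_rank (h2.trans (by simp; omega)) (x := Sum.elim g f) (by
      ext q
      rw [Matrix.fromCols_mulVec_sumElim, hinv, hM', Matrix.diagonal_mul_diagonal,
        ← Matrix.mulVec_mulVec, Pi.add_apply, Matrix.mulVec_diagonal, hV₁sum, hV₂sum, Pi.zero_apply,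
        ← hfg q]
      simp [colFactor, bOf]
      ring)
    exact ⟨funext fun c ↦ congrFun this (.inr c), funext fun c ↦ congrFun this (.inl c)⟩
  · have := mulVec_eq_zero_of_rank (h3.trans (by simp; omega)) (x := Sum.elim g f) (by
      ext q
      rw [Matrix.fromCols_mulVec_sumElim, hinv, hM', Matrix.diagonal_mul_diagonal,
        ← Matrix.mulVec_mulVec, Pi.add_apply, Matrix.mulVec_diagonal, hV₁sum, hV₃sum, Pi.zero_apply,
        ← hfg q]
      simp [colFactor, bOf]
      ring)
    exact ⟨funext fun c ↦ congrFun this (.inr c), funext fun c ↦ congrFun this (.inl c)⟩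

end UnicastNetwork

/-! ### Fractional linear relations between `b_i` and `η` -/

namespace UnicastNetwork

open MvPolynomial

theorem map_etaOf {L L' : Type*} [Field L] [Field L'] (φ : L →+* L') (M : Fin 3 → Fin 3 → L) :
    φ (etaOf M) = etaOf fun i j ↦ φ (M i j) := by
  simp [etaOf]

theorem map_bOf {L L' : Type*} [Field L] [Field L'] (φ : L →+* L') (M : Fin 3 → Fin 3 → L)
    (i : Fin 3) : φ (bOf M i) = bOf (fun i j ↦ φ (M i j)) i := by
  fin_cases i <;> simp [bOf]

section Numerators

variable {R : Type*} [CommRing R]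

/-- The numerator of `η`. -/
def etaNum (M : Fin 3 → Fin 3 → R) : R := M 1 0 * M 2 1 * M 0 2

/-- The denominator of `η`. -/
def etaDen (M : Fin 3 → Fin 3 → R) : R := M 2 0 * M 1 2 * M 0 1

/-- The numerators of `b₁, b₂, b₃`. -/
def bNum (M : Fin 3 → Fin 3 → R) : Fin 3 → R := ![M 1 0 * M 0 2, M 1 1 * M 0 2, M 2 2 * M 0 1]

/-- The denominators of `b₁, b₂, b₃`. -/
def bDen (M : Fin 3 → Fin 3 → R) : Fin 3 → R := ![M 0 0 * M 1 2, M 0 1 * M 1 2, M 0 2 * M 2 1]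

variable {S : Type*} [CommRing S] (φ : R →+* S) (M : Fin 3 → Fin 3 → R)

theorem map_etaNum : φ (etaNum M) = etaNum fun i j ↦ φ (M i j) := by simp [etaNum]

theorem map_etaDen : φ (etaDen M) = etaDen fun i j ↦ φ (M i j) := by simp [etaDen]

theorem map_bNum (i : Fin 3) : φ (bNum M i) = bNum (fun i j ↦ φ (M i j)) i := by
  fin_cases i <;> simp [bNum]

theorem map_bDen (i : Fin 3) : φ (bDen M i) = bDen (fun i j ↦ φ (M i j)) i := by
  fin_cases i <;> simp [bDen]

theorem etaOf_eq {L : Type*} [Field L] (M : Fin 3 → Fin 3 → L) :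
    etaOf M = etaNum M / etaDen M := rfl

theorem bOf_eq {L : Type*} [Field L] (M : Fin 3 → Fin 3 → L) (i : Fin 3) :
    bOf M i = bNum M i / bDen M i := by
  fin_cases i <;> rfl

variable {M} [IsDomain R]

theorem etaDen_ne_zero (hM : ∀ i j, M i j ≠ 0) : etaDen M ≠ 0 :=
  mul_ne_zero (mul_ne_zero (hM _ _) (hM _ _)) (hM _ _)

theorem bDen_ne_zero (hM : ∀ i j, M i j ≠ 0) (i : Fin 3) : bDen M i ≠ 0 := by
  fin_cases i <;> exact mul_ne_zero (hM _ _) (hM _ _)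

end Numerators

variable {V E : Type*} [DecidableEq V] [Fintype E] (N : UnicastNetwork V E)

/-- The transfer functions at `D = 1` as polynomials in the LECs. -/
def transferPoly (K : Type*) [Field K] : Fin 3 → Fin 3 → MvPolynomial N.LEC K :=
  N.transfer X 1

/-- The transfer functions at `D = 1` as rational functions of the LECs. -/
def transferRat (K : Type*) [Field K] : Fin 3 → Fin 3 → N.RatLEC K :=
  N.transfer (N.indet K) 1

theorem algebraMap_transferPoly (K : Type*) [Field K] (i j : Fin 3) :
    algebraMap _ (N.RatLEC K) (N.transferPoly K i j) = N.transferRat K i j := by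
  rw [transferPoly, map_transfer, map_one]
  rfl

theorem aeval_transferPoly {K L : Type*} [Field K] [CommRing L] [Algebra K L] (ε : N.LEC → L)
    (D : L) (i j : Fin 3) : aeval (D • ε) (N.transferPoly K i j) = N.transfer ε D i j := by
  have := N.map_transfer (aeval (D • ε) : MvPolynomial N.LEC K →ₐ[K] L).toRingHom X 1 i j
  refine this.trans ?_
  rw [map_one, N.transfer_eq_transfer_smul ε D]
  congr 1
  ext s
  simp

theorem map_transferPoly {F K : Type*} [Field F] [Field K] (ψ : F →+* K) (i j : Fin 3) :
    MvPolynomial.map ψ (N.transferPoly F i j) = N.transferPoly K i j := by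
  rw [transferPoly, map_transfer, map_one]
  congr 1
  ext s : 1
  simp

theorem transferRat_ne_zero_iff {K : Type*} [Field K] {i j : Fin 3} :
    N.transferRat K i j ≠ 0 ↔ N.transferPoly K i j ≠ 0 := by
  rw [← algebraMap_transferPoly, Ne, Ne, FaithfulSMul.algebraMap_eq_zero_iff]

theorem transferPoly_ne_zero_iff {F K : Type*} [Field F] [Field K] (ψ : F →+* K) {i j : Fin 3} :
    N.transferPoly K i j ≠ 0 ↔ N.transferPoly F i j ≠ 0 := by
  rw [← N.map_transferPoly ψ, Ne, Ne, map_eq_zero_iff _ (map_injective ψ ψ.injective)]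

/-- The extension of scalars for rational functions in the LECs. -/
def ratMap {F K : Type*} [Field F] [Field K] (ψ : F →+* K) : N.RatLEC F →+* N.RatLEC K :=
  IsFractionRing.lift (A := MvPolynomial N.LEC F)
    (g := (algebraMap (MvPolynomial N.LEC K) (N.RatLEC K)).comp (MvPolynomial.map ψ))
    ((FaithfulSMul.algebraMap_injective _ _).comp (map_injective ψ ψ.injective))

theorem ratMap_transferRat {F K : Type*} [Field F] [Field K] (ψ : F →+* K) (i j : Fin 3) :
    N.ratMap ψ (N.transferRat F i j) = N.transferRat K i j := by
  rw [← algebraMap_transferPoly, ← algebraMap_transferPoly, ← N.map_transferPoly ψ]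
  exact IsFractionRing.lift_algebraMap _ _

/-- `b_i` is a fractional linear function of `η`. -/
def FractionalLinearRelation (K : Type*) [Field K] (i : Fin 3) : Prop :=
  ∃ γ δ : Polynomial K, γ.natDegree ≤ 1 ∧ δ.natDegree ≤ 1 ∧ IsCoprime γ δ ∧
    bOf (N.transferRat K) i * Polynomial.aeval (etaOf (N.transferRat K)) δ =
      Polynomial.aeval (etaOf (N.transferRat K)) γ

/-- Clearing denominators gives a polynomial identity in the LECs, which may be evaluated at `Dε`.
-/
theorem FractionalLinearRelation.specialize {K L : Type*} [Field K] [Field L] [Algebra K L]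
    {γ δ : Polynomial K} (hγ : γ.natDegree ≤ 1) (hδ : δ.natDegree ≤ 1) {i : Fin 3}
    (h : bOf (N.transferRat K) i * Polynomial.aeval (etaOf (N.transferRat K)) δ =
      Polynomial.aeval (etaOf (N.transferRat K)) γ) {ε : N.LEC → L} {D : L}
    (hM : ∀ i j, N.transfer ε D i j ≠ 0) :
    bOf (N.transfer ε D) i * (algebraMap K L (δ.coeff 0) + algebraMap K L (δ.coeff 1) *
      etaOf (N.transfer ε D)) =
    algebraMap K L (γ.coeff 0) + algebraMap K L (γ.coeff 1) * etaOf (N.transfer ε D) := by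
  have hP : ∀ i j, N.transferPoly K i j ≠ 0 := by
    intro i j h0
    apply hM i j
    rw [← aeval_transferPoly (K := K), h0, map_zero]
  have hQ : ∀ i j, N.transferRat K i j ≠ 0 := fun i j ↦ N.transferRat_ne_zero_iff.mpr (hP i j)
  have hpoly : bNum (N.transferPoly K) i * (C (δ.coeff 0) * etaDen (N.transferPoly K) +
      C (δ.coeff 1) * etaNum (N.transferPoly K)) =
    bDen (N.transferPoly K) i * (C (γ.coeff 0) * etaDen (N.transferPoly K) +
      C (γ.coeff 1) * etaNum (N.transferPoly K)) := by
    apply FaithfulSMul.algebraMap_injective (MvPolynomial N.LEC K) (N.RatLEC K)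
    have hC : ∀ c : K, algebraMap (MvPolynomial N.LEC K) (N.RatLEC K) (C c) =
        algebraMap K (N.RatLEC K) c := fun c ↦
      (IsScalarTower.algebraMap_apply K (MvPolynomial N.LEC K) (N.RatLEC K) c).symm
    simp only [map_mul, map_add, map_bNum, map_bDen, map_etaNum, map_etaDen, hC,
      algebraMap_transferPoly]
    rw [Polynomial.eq_X_add_C_of_natDegree_le_one hγ,
      Polynomial.eq_X_add_C_of_natDegree_le_one hδ] at h
    simp only [map_add, map_mul, Polynomial.aeval_C, Polynomial.aeval_X, bOf_eq, etaOf_eq] at h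
    have h1 := etaDen_ne_zero hQ
    have h2 := bDen_ne_zero hQ i
    change bNum (N.transferRat K) i * (_ * etaDen (N.transferRat K) +
      _ * etaNum (N.transferRat K)) = bDen (N.transferRat K) i * (_ * etaDen (N.transferRat K) +
      _ * etaNum (N.transferRat K))
    field_simp at h
    linear_combination h
  have hL := congrArg (aeval (D • ε) : MvPolynomial N.LEC K →ₐ[K] L).toRingHom hpoly
  simp only [map_mul, map_add, map_bNum, map_bDen, map_etaNum, map_etaDen] at hL
  simp only [AlgHom.toRingHom_eq_coe, RingHom.coe_coe, aeval_transferPoly, aeval_C] at hL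
  change bNum (N.transfer ε D) i * (_ * etaDen (N.transfer ε D) +
      _ * etaNum (N.transfer ε D)) = bDen (N.transfer ε D) i * (_ * etaDen (N.transfer ε D) +
      _ * etaNum (N.transfer ε D)) at hL
  have h1 := etaDen_ne_zero hM
  have h2 := bDen_ne_zero hM i
  rw [bOf_eq, etaOf_eq]
  field_simp
  linear_combination hL

/-- The coefficients of the relation lie in `K` and the channels in `F`; both are moved to the
common extension `L`, where recoverability persists. -/
theorem FractionalLinearRelation.not_recoverable {K F L : Type*} [Field K] [Field F] [Field L]
    [Algebra K L] {i : Fin 3} (h : N.FractionalLinearRelation K i) (φ : F →+* L)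
    {ε : N.LEC → F} {a : F} {n' : ℕ} (hn' : 1 < n')
    (hM : ∀ (q : Fin (2 * n' + 1)) i j, N.transfer ε (a ^ (q : ℕ)) i j ≠ 0)
    (W : ∀ i, Matrix (Fin (2 * n' + 1)) (Fin (lens n' i)) F) :
    ¬ ∀ j, Recoverable (fun i j ↦ Matrix.diagonal fun q : Fin (2 * n' + 1) ↦
      N.transfer ε (a ^ (q : ℕ)) i j) W j := by
  intro hW
  obtain ⟨γ, δ, hγ, hδ, ⟨u, v, huv⟩, hrel⟩ := h
  have hM' : ∀ (q : Fin (2 * n' + 1)) i j,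
      N.transfer (φ ∘ ε) (φ (a ^ (q : ℕ))) i j = φ (N.transfer ε (a ^ (q : ℕ)) i j) :=
    fun q i j ↦ (N.map_transfer φ _ _ _ _).symm
  have hM0 : ∀ (q : Fin (2 * n' + 1)) i j, N.transfer (φ ∘ ε) (φ (a ^ (q : ℕ))) i j ≠ 0 :=
    fun q i j ↦ by rw [hM']; exact (map_ne_zero φ).mpr (hM q i j)
  refine UnicastNetwork.not_recoverable hn' hM0 (i := i) (g₀ := algebraMap K L (γ.coeff 0))
    (g₁ := algebraMap K L (γ.coeff 1)) (d₀ := algebraMap K L (δ.coeff 0))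
    (d₁ := algebraMap K L (δ.coeff 1)) (fun t ht ht' ↦ ?_)
    (fun q ↦ FractionalLinearRelation.specialize N hγ hδ hrel (hM0 q)) (fun i ↦ (W i).map φ)
    fun j ↦ ?_
  · have := congrArg (Polynomial.aeval t) huv
    rw [Polynomial.eq_X_add_C_of_natDegree_le_one hγ,
      Polynomial.eq_X_add_C_of_natDegree_le_one hδ] at this
    simp only [map_add, map_mul, Polynomial.aeval_C, Polynomial.aeval_X, map_one] at this
    rw [add_comm] at ht ht'
    rw [ht, ht', mul_zero, mul_zero, add_zero] at this
    exact zero_ne_one this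
  · convert (hW j).map φ using 3 with i' j'
    rw [Matrix.diagonal_map (map_zero φ)]
    congr 1
    ext q
    exact hM' q _ _

open Polynomial in
/-- If `b_i` is a rational function of `η`, then it is a fractional linear function of `η`. -/
theorem fractionalLinearRelation_of_aeval_eq {K : Type*} [Field K] [IsAlgClosed K]
    (hM : ∀ i j, N.transferPoly K i j ≠ 0)
    (hη : ∀ c, etaOf (N.transferRat K) ≠ algebraMap K (N.RatLEC K) c) {i : Fin 3}
    {f g : Polynomial K} (hfg : f ≠ 0 ∨ g ≠ 0)
    (h : Polynomial.aeval (etaOf (N.transferRat K)) f =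
      bOf (N.transferRat K) i * Polynomial.aeval (etaOf (N.transferRat K)) g) :
    N.FractionalLinearRelation K i := by
  classical
  -- Over an algebraically closed field an algebraic element is constant.
  have htr : Transcendental K (etaOf (N.transferRat K)) := by
    intro halg
    have := IntermediateField.isAlgebraic_adjoin_simple halg.isIntegral
    have hmem := IntermediateField.mem_adjoin_simple_self K (etaOf (N.transferRat K))
    rw [IntermediateField.eq_bot_of_isAlgClosed_of_isAlgebraic
      (IntermediateField.adjoin K {etaOf (N.transferRat K)}), IntermediateField.mem_bot] at hmem
    obtain ⟨c, hc⟩ := hmem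
    exact hη c hc.symm
  obtain ⟨d, f', g', hd, hcop, hf, hg⟩ : ∃ d f' g' : Polynomial K, d ≠ 0 ∧ IsCoprime f' g' ∧
      f = d * f' ∧ g = d * g' := by
    let := UniqueFactorizationMonoid.toGCDMonoid (Polynomial K)
    obtain ⟨f', g', hf, hg, hu⟩ := extract_gcd f g
    refine ⟨gcd f g, f', g', ?_, (gcd_isUnit_iff _ _).mp hu, hf, hg⟩
    rw [Ne, gcd_eq_zero_iff]
    tauto
  rw [hf, hg, map_mul, map_mul] at h
  have hd' : Polynomial.aeval (etaOf (N.transferRat K)) d ≠ 0 := fun h0 ↦ htr ⟨d, hd, h0⟩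
  have h' : Polynomial.aeval (etaOf (N.transferRat K)) f' =
      bOf (N.transferRat K) i * Polynomial.aeval (etaOf (N.transferRat K)) g' :=
    mul_left_cancel₀ hd' (by linear_combination h)
  have hb : ∀ {u v : MvPolynomial N.LEC K}, v ≠ 0 → (u = v ∨ FractionalLinear u v) →
      bOf (N.transferRat K) i = algebraMap _ _ u / algebraMap _ _ v →
      N.FractionalLinearRelation K i := by
    intro u v hv huv hbuv
    -- In the first case `b_i = 1`, and `1/1` is the relation whatever `f` and `g` are.
    rcases huv with rfl | huv
    · refine ⟨1, 1, by simp, by simp, isCoprime_one_left, ?_⟩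
      rw [hbuv, div_self (by rwa [Ne, FaithfulSMul.algebraMap_eq_zero_iff])]
      simp
    · rw [hbuv] at h'
      have := huv.natDegree_le_one hv hcop h'
      exact ⟨f', g', this.1, this.2, hcop, by rw [hbuv, h']⟩
  fin_cases i
  · refine hb (mul_ne_zero (hM _ _) (hM _ _)) (N.crossRatio (i₁ := 1) (j₁ := 0) (i₂ := 0) (j₂ := 2)
      _ rfl (hM _ _) (hM _ _) (hM _ _) (hM _ _)) ?_
    change _ = algebraMap _ _ (N.transferPoly K _ _ * N.transferPoly K _ _) /
      algebraMap _ _ (N.transferPoly K _ _ * N.transferPoly K _ _)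
    simp only [map_mul, algebraMap_transferPoly]
    simp [bOf, mul_comm]
  · refine hb (mul_ne_zero (hM _ _) (hM _ _)) (N.crossRatio (i₁ := 1) (j₁ := 1) (i₂ := 0) (j₂ := 2)
      _ rfl (hM _ _) (hM _ _) (hM _ _) (hM _ _)) ?_
    change _ = algebraMap _ _ (N.transferPoly K _ _ * N.transferPoly K _ _) /
      algebraMap _ _ (N.transferPoly K _ _ * N.transferPoly K _ _)
    simp only [map_mul, algebraMap_transferPoly]
    simp [bOf, mul_comm]
  · refine hb (mul_ne_zero (hM _ _) (hM _ _)) (N.crossRatio (i₁ := 2) (j₁ := 2) (i₂ := 0) (j₂ := 1)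
      _ rfl (hM _ _) (hM _ _) (hM _ _) (hM _ _)) ?_
    change _ = algebraMap _ _ (N.transferPoly K _ _ * N.transferPoly K _ _) /
      algebraMap _ _ (N.transferPoly K _ _ * N.transferPoly K _ _)
    simp only [map_mul, algebraMap_transferPoly]
    simp [bOf, mul_comm]

end UnicastNetwork

/-! ### Generic points and descent to finite fields -/

section Points

open MvPolynomial Module

/-- Finitely many linearly independent families of `card ι` polynomials stay linearly independent
on suitable `card ι` points, which may be taken outside a hypersurface. -/
theorem exists_points_ker_eq_bot {σ K ι J : Type*} [Field K] [Infinite K] [Fintype ι] [Finite J]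
    {P : MvPolynomial σ K} (hP : P ≠ 0) (h : J → ι → MvPolynomial σ K)
    (hh : ∀ j (x : ι → K), ∑ c, C (x c) * h j c = 0 → x = 0) :
    ∃ p : Fin (Fintype.card ι) → σ → K, (∀ l, eval (p l) P ≠ 0) ∧
      ∀ j (x : ι → K), (∀ l, ∑ c, x c * eval (p l) (h j c) = 0) → x = 0 := by
  classical
  have := Fintype.ofFinite J
  let A : ∀ {n : ℕ}, (Fin n → σ → K) → J → Matrix (Fin n) ι K :=
    fun p j ↦ Matrix.of fun l c ↦ eval (p l) (h j c)
  have hmem : ∀ {n : ℕ} (p : Fin n → σ → K) j x, x ∈ LinearMap.ker (A p j).mulVecLin ↔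
      ∀ l, ∑ c, x c * eval (p l) (h j c) = 0 := by
    intro n p j x
    rw [LinearMap.mem_ker, Matrix.mulVecLin_apply, funext_iff]
    refine forall_congr' fun l ↦ ?_
    simp [A, Matrix.mulVec, dotProduct, mul_comm]
  -- Points are added one at a time, each lowering the dimension of every nonzero kernel.
  suffices H : ∀ n, ∃ p : Fin n → σ → K, (∀ l, eval (p l) P ≠ 0) ∧
      ∀ j, finrank K (LinearMap.ker (A p j).mulVecLin) ≤ Fintype.card ι - n by
    obtain ⟨p, hp, hker⟩ := H (Fintype.card ι)
    refine ⟨p, hp, fun j x hx ↦ ?_⟩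
    have h0 : LinearMap.ker (A p j).mulVecLin = ⊥ := by
      have := hker j
      exact Submodule.finrank_eq_zero.mp (by omega)
    rw [← hmem, h0] at hx
    exact (Submodule.mem_bot K).mp hx
  intro n
  induction n with
  | zero =>
    refine ⟨Fin.elim0, fun l ↦ l.elim0, fun j ↦ ?_⟩
    have := Submodule.finrank_le (LinearMap.ker (A (Fin.elim0 : Fin 0 → σ → K) j).mulVecLin)
    rwa [finrank_fintype_fun_eq_card] at this
  | succ n ih =>
    obtain ⟨p, hp, hker⟩ := ih
    -- Each nonzero kernel supplies a nonzero polynomial that the new point must avoid; a trivial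
    -- kernel imposes nothing, hence `Q = 1`.
    have hx : ∀ j, ∃ Q : MvPolynomial σ K, Q ≠ 0 ∧
        (LinearMap.ker (A p j).mulVecLin ≠ ⊥ → ∃ x ∈ LinearMap.ker (A p j).mulVecLin,
          Q = ∑ c, C (x c) * h j c) := by
      intro j
      by_cases hbot : LinearMap.ker (A p j).mulVecLin = ⊥
      · exact ⟨1, one_ne_zero, fun h ↦ absurd hbot h⟩
      · obtain ⟨x, hx, hx0⟩ := Submodule.exists_mem_ne_zero_of_ne_bot hbot
        exact ⟨_, fun h0 ↦ hx0 (hh j x h0), fun _ ↦ ⟨x, hx, rfl⟩⟩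
    choose Q hQ0 hQ using hx
    obtain ⟨z, hz⟩ : ∃ z, eval z (P * ∏ j, Q j) ≠ 0 := by
      by_contra! hz
      exact mul_ne_zero hP (Finset.prod_ne_zero_iff.mpr fun j _ ↦ hQ0 j)
        (MvPolynomial.funext fun z ↦ by rw [hz, map_zero])
    rw [map_mul, map_prod] at hz
    have hzQ := Finset.prod_ne_zero_iff.mp (right_ne_zero_of_mul hz)
    refine ⟨Fin.cons z p, fun l ↦ ?_, fun j ↦ ?_⟩
    · refine Fin.cases ?_ (fun l ↦ ?_) l
      · simpa using left_ne_zero_of_mul hz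
      · simpa using hp l
    have hle : LinearMap.ker (A (Fin.cons z p : Fin (n + 1) → σ → K) j).mulVecLin ≤
        LinearMap.ker (A p j).mulVecLin := by
      intro x hx
      rw [hmem] at hx ⊢
      exact fun l ↦ by simpa using hx l.succ
    by_cases hbot : LinearMap.ker (A p j).mulVecLin = ⊥
    · rw [hbot, le_bot_iff] at hle
      rw [hle, finrank_bot]
      exact Nat.zero_le _
    · obtain ⟨x, hxmem, hxQ⟩ := hQ j hbot
      have hlt : LinearMap.ker (A (Fin.cons z p : Fin (n + 1) → σ → K) j).mulVecLin <
          LinearMap.ker (A p j).mulVecLin := by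
        refine lt_of_le_of_ne hle fun heq ↦ hzQ j (Finset.mem_univ j) ?_
        rw [← heq, hmem] at hxmem
        simpa [hxQ] using hxmem 0
      have := Submodule.finrank_lt_finrank_of_lt hlt
      have := hker j
      omega

/-- A finite set of elements of an algebraic closure of `𝔽₂` lies in some `𝔽_{2^m}`. -/
theorem exists_galoisField_ringHom {s : Set (AlgebraicClosure (ZMod 2))} (hs : s.Finite) :
    ∃ (m : ℕ) (_ : m ≠ 0) (φ : GaloisField 2 m →+* AlgebraicClosure (ZMod 2)),
      ∀ x ∈ s, ∃ y, φ y = x := by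
  have := hs.to_subtype
  set F := IntermediateField.adjoin (ZMod 2) s with hF
  have hfin : FiniteDimensional (ZMod 2) F :=
    IntermediateField.finiteDimensional_adjoin fun x _ ↦ Algebra.IsIntegral.isIntegral x
  have := Module.finite_of_finite (ZMod 2) (M := F)
  have hcard : Nat.card F = 2 ^ finrank (ZMod 2) F := by
    rw [Module.natCard_eq_pow_finrank (K := ZMod 2), Nat.card_zmod]
  have e := GaloisField.algEquivGaloisField 2 _ hcard
  refine ⟨finrank (ZMod 2) F, finrank_pos.ne', F.val.toRingHom.comp e.symm.toRingHom, fun x hx ↦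
    ⟨e ⟨x, IntermediateField.subset_adjoin _ _ hx⟩, ?_⟩⟩
  simp

end Points

/-! ### Feasibility of the block time-varying scheme -/

namespace UnicastNetwork

section Columns

variable {R S : Type*} [CommRing R] [CommRing S]

/-- The columns of `ColumnsIndependent`, with denominators cleared. -/
def clearedColumn (n' : ℕ) (M : Fin 3 → Fin 3 → R) (i : Fin 3) : Fin (n' + 1) ⊕ Fin n' → R
  | .inl c => etaNum M ^ (c : ℕ) * etaDen M ^ (n' - c) *
      ![bDen M 0, bDen M 1, bDen M 2 * etaDen M] i
  | .inr c => etaNum M ^ (c : ℕ) * etaDen M ^ (n' - c) *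
      ![bNum M 0, bNum M 1, bNum M 2 * etaNum M] i

theorem map_clearedColumn (φ : R →+* S) (n' : ℕ) (M : Fin 3 → Fin 3 → R) (i : Fin 3)
    (c : Fin (n' + 1) ⊕ Fin n') :
    φ (clearedColumn n' M i c) = clearedColumn n' (fun i j ↦ φ (M i j)) i c := by
  rcases c with c | c <;> fin_cases i <;>
    simp [clearedColumn, map_etaNum, map_etaDen, map_bNum, map_bDen]

theorem map_colFactor {L L' : Type*} [Field L] [Field L'] (φ : L →+* L') (M : Fin 3 → Fin 3 → L)
    (i : Fin 3) : φ (colFactor M i) = colFactor (fun i j ↦ φ (M i j)) i := by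
  fin_cases i <;> simp [colFactor, map_bOf, map_etaOf]

theorem sum_clearedColumn {L : Type*} [Field L] (n' : ℕ) {M : Fin 3 → Fin 3 → L}
    (hM : ∀ i j, M i j ≠ 0) (i : Fin 3) : ∃ w : L, w ≠ 0 ∧ ∀ x : Fin (n' + 1) ⊕ Fin n' → L,
    ∑ c, x c * clearedColumn n' M i c = w * ((∑ c, x (.inl c) * etaOf M ^ (c : ℕ)) +
      colFactor M i * ∑ c, x (.inr c) * etaOf M ^ (c : ℕ)) := by
  have h1 := etaDen_ne_zero hM
  have h2 := bDen_ne_zero hM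
  have hpow : ∀ c ≤ n', etaNum M ^ c * etaDen M ^ (n' - c) = etaDen M ^ n' * etaOf M ^ c := by
    intro c hc
    rw [etaOf_eq, div_pow, ← Nat.sub_add_cancel hc, pow_add, Nat.add_sub_cancel]
    field_simp
  refine ⟨etaDen M ^ n' * ![bDen M 0, bDen M 1, bDen M 2 * etaDen M] i,
    mul_ne_zero (pow_ne_zero _ h1) ?_, fun x ↦ ?_⟩
  · fin_cases i
    · exact h2 0
    · exact h2 1
    · exact mul_ne_zero (h2 2) h1
  have hfac : ![bDen M 0, bDen M 1, bDen M 2 * etaDen M] i * colFactor M i =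
      ![bNum M 0, bNum M 1, bNum M 2 * etaNum M] i := by
    have := h2 0
    have := h2 1
    have := h2 2
    fin_cases i <;> simp [colFactor, bOf_eq, etaOf_eq] <;> field_simp
  rw [Fintype.sum_sum_type, mul_add, Finset.mul_sum, ← mul_assoc, mul_assoc (etaDen M ^ n'), hfac,
    Finset.mul_sum]
  congr 1
  · refine Finset.sum_congr rfl fun c _ ↦ ?_
    rw [clearedColumn, hpow c (by omega)]
    ring
  · refine Finset.sum_congr rfl fun c _ ↦ ?_
    rw [clearedColumn, hpow c (by omega)]
    ring

end Columns

open Polynomial in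
theorem _root_.Polynomial.sum_fin_C_mul_X_pow_ne_zero {K : Type*} [Field K] {n : ℕ} {x : Fin n → K}
    (hx : x ≠ 0) : (∑ c, C (x c) * X ^ (c : ℕ) : K[X]) ≠ 0 := by
  intro h
  apply hx
  ext c
  have := congrArg (fun p ↦ p.coeff c) h
  simpa [finsetSum_coeff, coeff_X_pow, Fin.val_inj] using this

variable {V E : Type*} [DecidableEq V] [Fintype E] (N : UnicastNetwork V E)

open MvPolynomial in
theorem aeval_transfer_X_C {K : Type*} [Field K] {α : K} (hα : α ≠ 0) (i j : Fin 3) :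
    aeval (fun s ↦ C α⁻¹ * X s) (N.transfer X (C α : MvPolynomial N.LEC K) i j) =
      N.transferPoly K i j := by
  have := N.map_transfer (aeval fun s ↦ C α⁻¹ * X s :
    MvPolynomial N.LEC K →ₐ[K] MvPolynomial N.LEC K).toRingHom X (C α) i j
  refine this.trans ?_
  rw [transfer_eq_transfer_smul, transferPoly]
  congr 1
  ext s : 1
  simp only [AlgHom.toRingHom_eq_coe, RingHom.coe_coe, Pi.smul_apply, Function.comp_apply,
    aeval_X, smul_eq_mul, algHom_C, algebraMap_eq]
  rw [← mul_assoc, ← C_mul, mul_inv_cancel₀ hα, C_1, one_mul]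

open MvPolynomial in
-- Rescaling the LECs reduces to `D = 1`. A dependency then expresses `b_i` through `η`, and
-- `fractionalLinearRelation_of_aeval_eq` makes this a fractional linear relation.
theorem clearedColumn_independent {K : Type*} [Field K] [IsAlgClosed K]
    (hM : ∀ i j, N.transferPoly K i j ≠ 0)
    (hη : ∀ c, etaOf (N.transferRat K) ≠ algebraMap K (N.RatLEC K) c) {i : Fin 3}
    (hi : ¬ N.FractionalLinearRelation K i) {n' : ℕ} {α : K} (hα : α ≠ 0)
    {x : Fin (n' + 1) ⊕ Fin n' → K}
    (hx : ∑ c, C (x c) * clearedColumn n' (N.transfer X (C α : MvPolynomial N.LEC K)) i c = 0) :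
    x = 0 := by
  have hx1 := congrArg (aeval fun s ↦ C α⁻¹ * X s :
    MvPolynomial N.LEC K →ₐ[K] MvPolynomial N.LEC K).toRingHom hx
  rw [map_sum, map_zero] at hx1
  simp only [map_mul, map_clearedColumn, AlgHom.toRingHom_eq_coe, RingHom.coe_coe,
    N.aeval_transfer_X_C hα, algHom_C, algebraMap_eq] at hx1
  have hx2 := congrArg (algebraMap (MvPolynomial N.LEC K) (N.RatLEC K)) hx1
  have hC : ∀ c : K, algebraMap (MvPolynomial N.LEC K) (N.RatLEC K) (C c) =
      algebraMap K (N.RatLEC K) c := fun c ↦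
    (IsScalarTower.algebraMap_apply K (MvPolynomial N.LEC K) (N.RatLEC K) c).symm
  rw [map_sum, map_zero] at hx2
  simp only [map_mul, map_clearedColumn, algebraMap_transferPoly, hC] at hx2
  obtain ⟨w, hw, hsum⟩ := sum_clearedColumn n'
    (fun i j ↦ N.transferRat_ne_zero_iff.mpr (hM i j)) i
  have hx3 := (hsum fun c ↦ algebraMap K (N.RatLEC K) (x c)).symm.trans hx2
  have hx4 := (mul_eq_zero.mp hx3).resolve_left hw
  by_contra hx0
  have hx0' : (fun c ↦ x (.inl c)) ≠ 0 ∨ (fun c ↦ x (.inr c)) ≠ 0 := by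
    by_contra! h
    apply hx0
    ext c
    rcases c with c | c
    · exact congrFun h.1 c
    · exact congrFun h.2 c
  set f : Polynomial K := ∑ c, Polynomial.C (x (.inl c)) * Polynomial.X ^ (c : ℕ) with hf
  set g : Polynomial K := ∑ c, Polynomial.C (x (.inr c)) * Polynomial.X ^ (c : ℕ) with hg
  have hfg : f ≠ 0 ∨ g ≠ 0 := hx0'.imp Polynomial.sum_fin_C_mul_X_pow_ne_zero
    Polynomial.sum_fin_C_mul_X_pow_ne_zero
  have hrel : Polynomial.aeval (etaOf (N.transferRat K)) f +
      colFactor (N.transferRat K) i * Polynomial.aeval (etaOf (N.transferRat K)) g = 0 := by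
    rw [← hx4, hf, hg]
    simp
  apply hi
  fin_cases i
  · refine N.fractionalLinearRelation_of_aeval_eq hM hη (f := f) (g := -g) (by simpa using hfg) ?_
    simp [colFactor] at hrel ⊢
    linear_combination hrel
  · refine N.fractionalLinearRelation_of_aeval_eq hM hη (f := f) (g := -g) (by simpa using hfg) ?_
    simp [colFactor] at hrel ⊢
    linear_combination hrel
  -- The third column factor is `b₃ η`; its `η` is absorbed into `g`.
  · refine N.fractionalLinearRelation_of_aeval_eq hM hη (f := f) (g := -(g * Polynomial.X))
      (by simpa using hfg) ?_
    simp [colFactor] at hrel ⊢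
    linear_combination hrel

open MvPolynomial in
-- The same `2n' + 1` generic points over the algebraic closure serve all destinations and all `q`.
-- Having finitely many coordinates, they and the root of unity lie in some `𝔽_{2^m}`.
theorem blockTimeVaryingFeasible
    (hM : ∀ i j, N.transferPoly (AlgebraicClosure (ZMod 2)) i j ≠ 0)
    (hη : ∀ c, etaOf (N.transferRat (AlgebraicClosure (ZMod 2))) ≠
      algebraMap (AlgebraicClosure (ZMod 2)) _ c)
    (hi : ∀ i, ¬ N.FractionalLinearRelation (AlgebraicClosure (ZMod 2)) i) {k : ℕ} (hk : 1 < k)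
    (hodd : Odd k) : N.BlockTimeVaryingFeasible k := by
  intro n' _
  set K := AlgebraicClosure (ZMod 2)
  -- Primitive `k`-th roots of unity exist in characteristic two because `k` is odd.
  have : NeZero (k : K) := ⟨fun h ↦ by
    rw [CharP.cast_eq_zero_iff K 2] at h
    exact hodd.not_two_dvd_nat h⟩
  obtain ⟨α, hα⟩ := HasEnoughRootsOfUnity.exists_primitiveRoot K k
  have hα0 : ∀ q : ℕ, α ^ q ≠ 0 := fun q ↦ pow_ne_zero _ (hα.ne_zero (by omega))
  have hMq : ∀ (q : ℕ) i j, N.transfer X (C (α ^ q) : MvPolynomial N.LEC K) i j ≠ 0 := by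
    intro q i j h0
    apply hM i j
    rw [← N.aeval_transfer_X_C (hα0 q), h0, map_zero]
  have hP : (∏ t : Fin k × Fin 3 × Fin 3,
      N.transfer X (C (α ^ (t.1 : ℕ)) : MvPolynomial N.LEC K) t.2.1 t.2.2) ≠ 0 :=
    Finset.prod_ne_zero_iff.mpr fun t _ ↦ hMq _ _ _
  have hpts := exists_points_ker_eq_bot hP
    (fun (t : Fin 3 × Fin k) (c : Fin (n' + 1) ⊕ Fin n') ↦
      clearedColumn n' (N.transfer X (C (α ^ (t.2 : ℕ)) : MvPolynomial N.LEC K)) t.1 c)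
    (fun t x hx ↦ N.clearedColumn_independent hM hη (hi t.1) (hα0 t.2) hx)
  have hcard : Fintype.card (Fin (n' + 1) ⊕ Fin n') = 2 * n' + 1 := by
    simp
    omega
  rw [hcard] at hpts
  obtain ⟨p, hpP, hpind⟩ := hpts
  obtain ⟨m, hm, φ, hφ⟩ := exists_galoisField_ringHom
    (s := insert α (Set.range fun t : Fin (2 * n' + 1) × N.LEC ↦ p t.1 t.2))
    ((Set.finite_range _).insert _)
  obtain ⟨a, ha⟩ := hφ α (Set.mem_insert _ _)
  choose ε hε using fun l s ↦ hφ (p l s) (Set.mem_insert_of_mem _ ⟨(l, s), rfl⟩)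
  have hev : ∀ l (q : ℕ) i j, eval (p l) (N.transfer X (C (α ^ q) : MvPolynomial N.LEC K) i j) =
      φ (N.transfer (ε l) (a ^ q) i j) := by
    intro l q i j
    rw [map_transfer, map_transfer, eval_C, map_pow φ, ha]
    congr 1
    ext s
    simp [hε]
  refine ⟨m, hm, a, IsPrimitiveRoot.of_map_of_injective (f := φ) (by rwa [ha]) φ.injective, ε,
    fun q _ hqk ↦ ?_⟩
  have hne : ∀ l i j, N.transfer (ε l) (a ^ q) i j ≠ 0 := by
    intro l i j h0
    have := hpP l
    rw [map_prod, Finset.prod_ne_zero_iff] at this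
    apply this (⟨q, hqk⟩, i, j) (Finset.mem_univ _)
    rw [hev, h0, map_zero]
  refine ⟨fun i j ↦ ?_, exists_recoverable (M := fun l ↦ N.transfer (ε l) (a ^ q)) hne
    fun i f g hfg ↦ ?_⟩
  · rw [blockM, Matrix.isUnit_diagonal, Pi.isUnit_iff]
    exact fun l ↦ (hne l i j).isUnit
  have hx := hpind (i, ⟨q, hqk⟩) (Sum.elim (φ ∘ f) (φ ∘ g)) fun l ↦ by
    have hne' : ∀ i j, φ (N.transfer (ε l) (a ^ q) i j) ≠ 0 := fun i j ↦
      (map_ne_zero φ).mpr (hne l i j)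
    obtain ⟨w, -, hw⟩ := sum_clearedColumn n' hne' i
    simp only [map_clearedColumn, hev]
    rw [hw]
    have h0 := congrArg φ (hfg l)
    simp only [map_add, map_mul, map_sum, map_pow, map_zero, map_etaOf, map_colFactor] at h0
    exact mul_eq_zero_of_right w h0
  constructor
  · ext c
    have := congrFun hx (.inl c)
    simpa using this
  · ext c
    have := congrFun hx (.inr c)
    simpa using this

end UnicastNetwork

/-! ### Change of base field and conclusion -/

namespace UnicastNetwork

variable {V E : Type*} (N : UnicastNetwork V E)

theorem const_one {F : Type*} [Field F] : N.const (1 : F) = 1 := by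
  rw [const, MvPolynomial.C_1, map_one]

variable [DecidableEq V] [Fintype E]

theorem etaAt_zero {F : Type*} [Field F] (a : F) : N.etaAt a 0 = etaOf (N.transferRat F) := by
  rw [etaAt, pow_zero, const_one]
  rfl

theorem bAt_zero {F : Type*} [Field F] (a : F) (i : Fin 3) :
    N.bAt a 0 i = bOf (N.transferRat F) i := by
  rw [bAt, pow_zero, const_one]
  rfl

theorem etaOf_transferRat_ne_algebraMap {F K : Type*} [Field F] [Field K] (ψ : F →+* K)
    (h : ∀ c : F, etaOf (N.transferRat F) ≠ N.const c) (c : K) :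
    etaOf (N.transferRat K) ≠ algebraMap K (N.RatLEC K) c := by
  intro hc
  -- A zero denominator would make `η` the constant `0`, as `x / 0 = 0`.
  have hden : etaDen (N.transferPoly F) ≠ 0 := by
    intro h0
    apply h 0
    have : etaDen (N.transferRat F) = 0 := by
      have := congrArg (algebraMap (MvPolynomial N.LEC F) (N.RatLEC F)) h0
      rw [map_etaDen, map_zero] at this
      simpa only [algebraMap_transferPoly] using this
    rw [etaOf_eq, this, div_zero, const, map_zero, map_zero]
  have hdenK : etaDen (N.transferRat K) ≠ 0 := by
    have := (map_ne_zero_iff (algebraMap (MvPolynomial N.LEC K) (N.RatLEC K))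
      (FaithfulSMul.algebraMap_injective _ _)).mpr
      ((map_ne_zero_iff _ (MvPolynomial.map_injective ψ ψ.injective)).mpr hden)
    simpa only [map_etaDen, map_transferPoly, algebraMap_transferPoly] using this
  have hK : MvPolynomial.map ψ (etaNum (N.transferPoly F)) =
      MvPolynomial.C c * MvPolynomial.map ψ (etaDen (N.transferPoly F)) := by
    apply FaithfulSMul.algebraMap_injective (MvPolynomial N.LEC K) (N.RatLEC K)
    rw [etaOf_eq, div_eq_iff hdenK] at hc
    simp only [map_mul, map_etaNum, map_etaDen, map_transferPoly, algebraMap_transferPoly]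
    refine hc.trans ?_
    rw [IsScalarTower.algebraMap_apply K (MvPolynomial N.LEC K) (N.RatLEC K)]
    rfl
  obtain ⟨s, hs⟩ := MvPolynomial.ne_zero_iff.mp hden
  -- A constant value of `η` over `K` is a quotient of coefficients of polynomials over `F`, so it
  -- already lies in `F`.
  set c' : F := (etaNum (N.transferPoly F)).coeff s / (etaDen (N.transferPoly F)).coeff s with hc'
  have hcc : ψ c' = c := by
    have := congrArg (MvPolynomial.coeff s) hK
    rw [MvPolynomial.coeff_C_mul, MvPolynomial.coeff_map, MvPolynomial.coeff_map] at this
    rw [hc', map_div₀, this, mul_div_cancel_right₀ _ ((map_ne_zero ψ).mpr hs)]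
  have hF : etaNum (N.transferPoly F) = MvPolynomial.C c' * etaDen (N.transferPoly F) := by
    apply MvPolynomial.map_injective ψ ψ.injective
    rw [hK, map_mul, MvPolynomial.map_C, hcc]
  apply h c'
  have hdenF : etaDen (N.transferRat F) ≠ 0 := by
    have := (map_ne_zero_iff (algebraMap (MvPolynomial N.LEC F) (N.RatLEC F))
      (FaithfulSMul.algebraMap_injective _ _)).mpr hden
    simpa only [map_etaDen, algebraMap_transferPoly] using this
  have := congrArg (algebraMap (MvPolynomial N.LEC F) (N.RatLEC F)) hF
  simp only [map_mul, map_etaNum, map_etaDen, algebraMap_transferPoly] at this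
  rw [etaOf_eq, div_eq_iff hdenF]
  exact this

/-- If `η` is not constant, then the transfer functions between different sessions do not vanish. -/
theorem transferPoly_ne_zero_of_ne {F : Type*} [Field F]
    (h : etaOf (N.transferRat F) ≠ 0) {i j : Fin 3} (hij : i ≠ j) : N.transferPoly F i j ≠ 0 := by
  rw [← transferRat_ne_zero_iff]
  intro h0
  apply h
  -- Each of the six cross channels is a factor of `η`, above or below; division by zero gives zero.
  fin_cases i <;> fin_cases j <;> simp_all [etaOf]

theorem transferRat_const_ne_zero {F : Type*} [Field F] {α : F} (hα : α ≠ 0) {i j : Fin 3} :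
    N.transfer (N.indet F) (N.const α) i j ≠ 0 ↔ N.transferPoly F i j ≠ 0 := by
  have h1 : algebraMap (MvPolynomial N.LEC F) (N.RatLEC F)
      (N.transfer MvPolynomial.X (MvPolynomial.C α) i j) =
        N.transfer (N.indet F) (N.const α) i j := by
    rw [map_transfer]
    rfl
  rw [← h1, Ne, FaithfulSMul.algebraMap_eq_zero_iff, not_iff_not]
  constructor
  · intro h0
    rw [← N.aeval_transfer_X_C hα, h0, map_zero]
  · intro h0
    have h2 := N.aeval_transferPoly (K := F) MvPolynomial.X (MvPolynomial.C α) i j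
    rw [← h2, h0, map_zero]

variable {N} in
-- Cross channels are nonzero because `η` is, direct channels because of the rank conditions.
theorem TimeInvariantFeasible.transferPoly_ne_zero {n' m : ℕ} {a : GaloisField 2 m} (hn' : n' ≠ 0)
    (hη : etaOf (N.transferRat (GaloisField 2 m)) ≠ 0) (ha : IsPrimitiveRoot a (2 * n' + 1))
    (h : N.RankConditions (N.indet (GaloisField 2 m)) (N.const a) n') (i j : Fin 3) :
    N.transferPoly (GaloisField 2 m) i j ≠ 0 := by
  by_cases hij : i = j
  · subst hij
    intro h0
    apply h.hatM_ne_zero N hn' i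
    rw [hatM, Matrix.diagonal_eq_zero]
    ext q
    by_contra hne
    have : N.const a ^ (q : ℕ) = N.const (a ^ (q : ℕ)) := by
      simp only [const, map_pow]
    rw [this] at hne
    exact (N.transferRat_const_ne_zero (pow_ne_zero _ (ha.ne_zero (by omega)))).mp hne h0
  · exact N.transferPoly_ne_zero_of_ne hη hij

section ClosedField

/-- An embedding of `𝔽_{2^m}` into the algebraic closure of `𝔽₂`. -/
def galoisFieldEmb (m : ℕ) : GaloisField 2 m →+* AlgebraicClosure (ZMod 2) :=
  (IsAlgClosed.lift : GaloisField 2 m →ₐ[ZMod 2] AlgebraicClosure (ZMod 2)).toRingHom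

variable {N}

theorem TimeInvariantFeasible.transferPoly_ne_zero_closure
    (hη : ∀ c, etaOf (N.transferRat (AlgebraicClosure (ZMod 2))) ≠
      algebraMap (AlgebraicClosure (ZMod 2)) _ c) {n' : ℕ} (hn' : 1 < n')
    (h : N.TimeInvariantFeasible n') (i j : Fin 3) :
    N.transferPoly (AlgebraicClosure (ZMod 2)) i j ≠ 0 := by
  obtain ⟨m, -, a, ha, h⟩ := h
  rw [N.transferPoly_ne_zero_iff (galoisFieldEmb m)]
  refine TimeInvariantFeasible.transferPoly_ne_zero (by omega) (fun h0 ↦ hη 0 ?_) ha h i j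
  have := congrArg (N.ratMap (galoisFieldEmb m)) h0
  rw [map_etaOf, map_zero] at this
  simp only [ratMap_transferRat] at this
  exact this.trans (map_zero _).symm

theorem TimeInvariantFeasibleAny.transferPoly_ne_zero_closure {n' : ℕ}
    (h : N.TimeInvariantFeasibleAny n') (i j : Fin 3) :
    N.transferPoly (AlgebraicClosure (ZMod 2)) i j ≠ 0 := by
  obtain ⟨m, -, a, ha, ε, hu, -⟩ := h
  rw [N.transferPoly_ne_zero_iff (galoisFieldEmb m)]
  intro h0
  have := hu i j
  rw [hatM, Matrix.isUnit_diagonal, Pi.isUnit_iff] at this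
  apply (this 0).ne_zero
  rw [← N.aeval_transferPoly (K := GaloisField 2 m), h0, map_zero]

/-- The rank conditions make the explicit precoders decodable over `𝔽_{2^m}(ε)`, so the obstruction
to arbitrary precoding applies after extension to `K(ε)`. -/
theorem FractionalLinearRelation.not_timeInvariantFeasible
    (hη : ∀ c, etaOf (N.transferRat (AlgebraicClosure (ZMod 2))) ≠
      algebraMap (AlgebraicClosure (ZMod 2)) _ c) {i : Fin 3}
    (hi : N.FractionalLinearRelation (AlgebraicClosure (ZMod 2)) i) {n' : ℕ} (hn' : 1 < n') :
    ¬ N.TimeInvariantFeasible n' := by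
  intro hfeas
  have hP := hfeas.transferPoly_ne_zero_closure hη hn'
  obtain ⟨m, -, a, ha, h⟩ := hfeas
  have hM : ∀ (q : Fin (2 * n' + 1)) i j,
      N.transfer (N.indet (GaloisField 2 m)) (N.const a ^ (q : ℕ)) i j ≠ 0 := by
    intro q i j
    have : N.const a ^ (q : ℕ) = N.const (a ^ (q : ℕ)) := by
      simp only [const, map_pow]
    rw [this, N.transferRat_const_ne_zero (pow_ne_zero _ (ha.ne_zero (by omega))),
      ← N.transferPoly_ne_zero_iff (galoisFieldEmb m)]
    exact hP i j
  obtain ⟨W, hW⟩ := exists_recoverable hM fun i ↦ h.columnsIndependent N hM i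
  exact hi.not_recoverable N (N.ratMap (galoisFieldEmb m)) hn' hM W hW

theorem FractionalLinearRelation.not_timeInvariantFeasibleAny {i : Fin 3}
    (hi : N.FractionalLinearRelation (AlgebraicClosure (ZMod 2)) i) {n' : ℕ} (hn' : 1 < n') :
    ¬ N.TimeInvariantFeasibleAny n' := by
  rintro ⟨m, -, a, ha, ε, hu, W, hW⟩
  refine hi.not_recoverable N (galoisFieldEmb m) (ε := ε) (a := a) hn' (fun q i j ↦ ?_) W hW
  have := hu i j
  rw [hatM, Matrix.isUnit_diagonal, Pi.isUnit_iff] at this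
  exact (this q).ne_zero

theorem fractionalLinearRelation_of_mem_exceptional {m : ℕ} {a : GaloisField 2 m}
    (hη : ∀ c : GaloisField 2 m, N.etaAt a 0 ≠ N.const c) {i : Fin 3}
    (h : N.bAt a 0 i ∈ N.exceptional a 0) :
    N.FractionalLinearRelation (AlgebraicClosure (ZMod 2)) i := by
  set ψ := N.ratMap (galoisFieldEmb m)
  have hψη : ψ (N.etaAt a 0) = etaOf (N.transferRat (AlgebraicClosure (ZMod 2))) := by
    rw [etaAt_zero, map_etaOf]
    simp only [ψ, ratMap_transferRat]
  have hψb : ψ (N.bAt a 0 i) = bOf (N.transferRat (AlgebraicClosure (ZMod 2))) i := by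
    rw [bAt_zero, map_bOf]
    simp only [ψ, ratMap_transferRat]
  have hcop : IsCoprime (Polynomial.X : Polynomial (AlgebraicClosure (ZMod 2)))
      (Polynomial.X + 1) := ⟨-1, 1, by ring⟩
  have hdeg : (Polynomial.X + 1 : Polynomial (AlgebraicClosure (ZMod 2))).natDegree ≤ 1 := by
    rw [← Polynomial.C_1, Polynomial.natDegree_X_add_C]
  simp only [exceptional, Set.mem_insert_iff, Set.mem_singleton_iff] at h
  rcases h with h | h | h | h
  · refine ⟨1, 1, by simp, by simp, isCoprime_one_left, ?_⟩
    rw [← hψb, h]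
    simp
  · refine ⟨Polynomial.X, 1, by simp, by simp, isCoprime_one_right, ?_⟩
    rw [← hψb, h, hψη]
    simp
  · refine ⟨Polynomial.X + 1, 1, hdeg, by simp, isCoprime_one_right, ?_⟩
    rw [← hψb, h, map_add, hψη]
    simp
  · refine ⟨Polynomial.X, Polynomial.X + 1, by simp, hdeg, hcop, ?_⟩
    -- `η + 1 = 0` would make `η` constant.
    have hne : N.etaAt a 0 + 1 ≠ 0 := fun h0 ↦ hη (-1) (by
      rw [eq_neg_of_add_eq_zero_left h0, const, map_neg, map_neg, map_one, map_one])
    have hne' : etaOf (N.transferRat (AlgebraicClosure (ZMod 2))) + 1 ≠ 0 := by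
      rw [← hψη, ← map_one ψ, ← map_add]
      exact (map_ne_zero ψ).mpr hne
    rw [← hψb, h, map_div₀, map_add, hψη]
    simp [hne']

end ClosedField

end UnicastNetwork

end

theorem mainTheorem10 {V E : Type*} [DecidableEq V] [Fintype E] (N : UnicastNetwork V E)
    (hcut : ∀ i j, 1 ≤ N.minCut i j) (m : ℕ) (hm : m ≠ 0) (a : GaloisField 2 m)
    (hη : ∀ c : GaloisField 2 m, N.etaAt a 0 ≠ N.const c) :
    ((∃ i, N.bAt a 0 i ∈ N.exceptional a 0) →
      ∀ n' : ℕ, 1 < n' → ¬ N.TimeInvariantFeasible n' ∧ ¬ N.TimeInvariantFeasibleAny n') ∧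
    (∀ k : ℕ, 1 < k → Odd k → ¬ N.BlockTimeVaryingFeasible k →
      ∀ n' : ℕ, 1 < n' → ¬ N.TimeInvariantFeasible n' ∧ ¬ N.TimeInvariantFeasibleAny n') := by
  have hηK := N.etaOf_transferRat_ne_algebraMap (UnicastNetwork.galoisFieldEmb m)
    (fun c ↦ by rw [← N.etaAt_zero a]; exact hη c)
  refine ⟨fun ⟨i, hi⟩ n' hn' ↦ ?_, fun k hk hodd hb n' hn' ↦ ⟨fun h ↦ hb ?_, fun h ↦ hb ?_⟩⟩
  · have hrel := UnicastNetwork.fractionalLinearRelation_of_mem_exceptional hη hi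
    exact ⟨hrel.not_timeInvariantFeasible hηK hn', hrel.not_timeInvariantFeasibleAny hn'⟩
  -- Feasibility for a single `n'` rules out every relation, which suffices for block feasibility at
  -- all lengths.
  · exact N.blockTimeVaryingFeasible (h.transferPoly_ne_zero_closure hηK hn') hηK
      (fun i hi ↦ hi.not_timeInvariantFeasible hηK hn' h) hk hodd
  · exact N.blockTimeVaryingFeasible h.transferPoly_ne_zero_closure hηK
      (fun i hi ↦ hi.not_timeInvariantFeasibleAny hn' h) hk hodd
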